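/- A Fuchsian group is a finitely generated non-elementary discrete subgroup of $\mathrm{PSL}(2,\mathbb{R})$. Let $\Gamma$ be a co-compact Fuchsian group with signature $(g;n_1,\ldots,n_k)$, where $g,k\ge 0$ and $n_i\ge 2$; that is, $\Gamma$ has a presentation with generators $a_1,b_1,\ldots,a_g,b_g,x_1,\ldots,x_k$ and relations $$x_1^{n_1}=\cdots=x_k^{n_k}=x_1\cdots x_k\,[a_1,b_1]\cdots[a_g,b_g]=1,\qquad [a,b]=a^{-1}b^{-1}ab.$$ Let $\mathfrak{n}:=\operatorname{lcm}(n_1,\ldots,n_k)$ (so $\mathfrak{n}=1$ if $k=0$), and assume that all periods are equal: $n_1=\cdots=n_k=\mathfrak{n}$. Let $n$ be a positive integer. An epimorphism $\Gamma\to\mathbb{Z}_n$ is called surface-kernel if its kernel is a Fuchsian surface group, that is, a Fuchsian group without periods (without nontrivial elements of finite order). If $\mathfrak{n}\nmid n$, then there is no surface-kernel epimorphism from $\Gamma$ to $\mathbb{Z}_n$. If $\mathfrak{n}\mid n$, then the number of surface-kernel epimorphisms from $\Gamma$ to $\mathbb{Z}_n$ is finite and equal to $$\frac{n^{2g}\,\varphi(\mathfrak{n})^k}{\mathfrak{n}}\prod_{p\,\mid\,n/\mathfrak{n}}\left(1-\frac{1}{p^{2g}}\right)\prod_{p\,\mid\,\mathfrak{n}}\left(1-\frac{(-1)^{k-1}}{(p-1)^{k-1}}\right),$$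 where $\varphi$ is Euler's totient function and the products run over the prime divisors $p$ of $n/\mathfrak{n}$ and of $\mathfrak{n}$, respectively. -/

import Mathlib

open scoped MatrixGroups

/-- The preimage in `SL(2, ℝ)` of a subgroup of `PSL(2, ℝ)`.  It acts on the hyperbolic plane `ℍ` and
on its boundary circle `ℙ¹(ℝ)` by Möbius transformations, with the same orbits as the subgroup of
`PSL(2, ℝ)` itself. -/
def pslLift (Γ : Subgroup PSL(2, ℝ)) : Subgroup SL(2, ℝ) :=
  Γ.comap (QuotientGroup.mk' (Subgroup.center SL(2, ℝ)))

/-- A subgroup of `PSL(2, ℝ)` is elementary if it has a finite orbit in the closed hyperbolic plane,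
that is, in `ℍ` or in the boundary `ℙ¹(ℝ)`. -/
def IsElementaryPSL (Γ : Subgroup PSL(2, ℝ)) : Prop :=
  (∃ z : UpperHalfPlane, (MulAction.orbit (pslLift Γ) z).Finite) ∨
    ∃ x : Projectivization ℝ (Fin 2 → ℝ), (MulAction.orbit (pslLift Γ) x).Finite

/-- A Fuchsian group: a finitely generated non-elementary discrete subgroup of `PSL(2, ℝ)`. -/
structure IsFuchsian (Γ : Subgroup PSL(2, ℝ)) : Prop where
  fg : Γ.FG
  discrete : DiscreteTopology Γ
  nonelementary : ¬ IsElementaryPSL Γ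

/-- A Fuchsian surface group: a Fuchsian group without periods, i.e. without nontrivial elements of
finite order (the nontrivial elements of finite order of a Fuchsian group are its elliptic ones). -/
structure IsFuchsianSurfaceGroup (Γ : Subgroup PSL(2, ℝ)) : Prop where
  fuchsian : IsFuchsian Γ
  torsionFree : ∀ γ ∈ Γ, IsOfFinOrder γ → γ = 1

/-- The generators `a₁, b₁, …, a_g, b_g, x₁, …, x_k` of the standard presentation. -/
inductive FuchsianGen (g k : ℕ) : Type
  | a (j : Fin g) : FuchsianGen g k
  | b (j : Fin g) : FuchsianGen g k
  | x (i : Fin k) : FuchsianGen g k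

/-- The word `x₁ ⋯ x_k [a₁, b₁] ⋯ [a_g, b_g]`, where `[a, b] = a⁻¹ b⁻¹ a b`. -/
def fuchsianLongWord (g k : ℕ) : FreeGroup (FuchsianGen g k) :=
  (List.ofFn fun i : Fin k => FreeGroup.of (FuchsianGen.x i)).prod *
    (List.ofFn fun j : Fin g =>
      (FreeGroup.of (FuchsianGen.a j))⁻¹ * (FreeGroup.of (FuchsianGen.b j))⁻¹ *
        FreeGroup.of (FuchsianGen.a j) * FreeGroup.of (FuchsianGen.b j)).prod

/-- The relators `x₁ ^ n₁, …, x_k ^ n_k` and `x₁ ⋯ x_k [a₁, b₁] ⋯ [a_g, b_g]`. -/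
def fuchsianRels (g : ℕ) {k : ℕ} (ν : Fin k → ℕ) : Set (FreeGroup (FuchsianGen g k)) :=
  Set.range (fun i : Fin k => FreeGroup.of (FuchsianGen.x i) ^ ν i) ∪ {fuchsianLongWord g k}

/-- `Γ` is a co-compact Fuchsian group with signature `(g; ν₁, …, ν_k)`: a Fuchsian group which has
the standard presentation with orbit genus `g` and periods `ν₁, …, ν_k ≥ 2`, without parabolic
generators and hyperbolic boundary generators. -/
structure IsCocompactFuchsianWithSignature (Γ : Subgroup PSL(2, ℝ)) (g : ℕ) {k : ℕ}
    (ν : Fin k → ℕ) : Prop where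
  fuchsian : IsFuchsian Γ
  two_le_period : ∀ i, 2 ≤ ν i
  presentation : Nonempty (PresentedGroup (fuchsianRels g ν) ≃* Γ)

/-- A homomorphism from a Fuchsian group to a group `G` is a surface-kernel epimorphism if it is
surjective and its kernel is a Fuchsian surface group. -/
structure IsSurfaceKernelEpi {Γ : Subgroup PSL(2, ℝ)} {G : Type*} [Group G] (φ : Γ →* G) :
    Prop where
  surjective : Function.Surjective φ
  ker_surface : IsFuchsianSurfaceGroup (φ.ker.map Γ.subtype)

/-- The set of surface-kernel epimorphisms from `Γ` to the cyclic group of order `n`. -/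
def surfaceKernelEpis (Γ : Subgroup PSL(2, ℝ)) (n : ℕ) : Set (Γ →* Multiplicative (ZMod n)) :=
  {φ | IsSurfaceKernelEpi φ}

/-! The kernel of an epimorphism onto a finite group has finite index, so it is again Fuchsian
(`IsFuchsian.map_subtype`). Being surface-kernel is therefore a question of torsion. The key
equivalence `isSurfaceKernelEpi_iff` says that the kernel is torsion-free exactly when every
elliptic generator `xᵢ` has image of order `N`.

Sufficiency rests on a torsion theorem, `orderOf_eq_one_of_free`, proved algebraically from the
presentation and the infiniteness of `Γ`. The presentation describes a plane tessellated by
translates of one polygon, with cellular chains `ℤΓ → ℤΓ^gens → ℤΓ ⊕ ⨁ ℤ[Γ/⟨xᵢ⟩]`. This complex is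
exact in degree one because the relators generate all relations, and in degree two because `Γ` is
infinite. A cyclic group of order `m` acting freely on the base and cone vertices would act freely
on an acyclic complex, and a count of augmentations then gives `m ∣ 1`. Hence all torsion comes from
conjugates of the `⟨xᵢ⟩`. Necessity needs `xᵢ` to have order `N` already in `Γ`, shown by a cyclic
quotient when `k ≥ 2`. For `k = 1` the image of `x₁` is trivial, and it is enough that `x₁ ≠ 1`,
shown by a dihedral quotient or, in genus zero, by infiniteness.

Epimorphisms then correspond to generating vectors in `ℤ/n` (`nonempty_surfaceKernelEpis_equiv`).
With `n = N * M`, the images of the `xᵢ` are `M` times units of `ℤ/N` with sum zero, while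
generation only constrains the images of the `aⱼ, bⱼ` modulo primes dividing `M`. The count is thus
a product (`card_generatingVectors`), and the Chinese remainder theorem evaluates both factors prime
by prime. -/

/-! ### Group rings and permutation modules over a finite cyclic subgroup. -/

section FreeCyclicAction

variable {G : Type*} [Group G]

/-- The norm element `1 + γ + ⋯ + γ ^ (m - 1)` of the integral group ring, `m` the order of `γ`. -/
noncomputable def normElement (γ : G) : MonoidAlgebra ℤ G :=
  ∑ j ∈ Finset.range (orderOf γ), MonoidAlgebra.of ℤ G γ ^ j

theorem sub_one_mul_normElement (γ : G) :
    (MonoidAlgebra.of ℤ G γ - 1) * normElement γ = 0 := by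
  rw [normElement, mul_geom_sum, ← map_pow, pow_orderOf_eq_one, map_one, sub_self]

theorem normElement_mul_sub_one (γ : G) :
    normElement γ * (MonoidAlgebra.of ℤ G γ - 1) = 0 := by
  rw [normElement, geom_sum_mul, ← map_pow, pow_orderOf_eq_one, map_one, sub_self]

/-- The powers `γ ^ j` with `j < orderOf γ` list `⟨γ⟩` without repetition, so exactly one term
survives. -/
theorem sum_ite_pow_mul_eq {A : Type*} [AddCommMonoid A] {γ : G} (hγ : 0 < orderOf γ) {g r : G}
    (hr : r * g⁻¹ ∈ Subgroup.zpowers γ) (c : A) [DecidableEq G] :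
    (∑ j ∈ Finset.range (orderOf γ), if γ ^ j * g = r then c else 0) = c := by
  have hfin : IsOfFinOrder γ := orderOf_pos_iff.1 hγ
  obtain ⟨n, hn⟩ := (hfin.mem_powers_iff_mem_zpowers.2 hr : r * g⁻¹ ∈ Submonoid.powers γ)
  have hn : γ ^ n = r * g⁻¹ := hn
  have hn' : γ ^ (n % orderOf γ) = r * g⁻¹ := by rw [pow_mod_orderOf, hn]
  rw [Finset.sum_eq_single (n % orderOf γ)]
  · rw [if_pos (by rw [hn']; group)]
  · intro j hj hne
    rw [if_neg]
    intro h
    apply hne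
    have : γ ^ j = γ ^ (n % orderOf γ) := by rw [hn', ← h]; group
    exact pow_injOn_Iio_orderOf (by simpa using hj) (Nat.mod_lt _ hγ) this
  · intro h
    exact absurd (Finset.mem_range.2 (Nat.mod_lt _ hγ)) h

/-- A representative of the coset `⟨γ⟩ g`. -/
noncomputable def cosetRep (γ g : G) : G :=
  (Quotient.mk (QuotientGroup.rightRel (Subgroup.zpowers γ)) g).out

theorem cosetRep_mul_inv_mem (γ g : G) : cosetRep γ g * g⁻¹ ∈ Subgroup.zpowers γ := by
  have h := Quotient.mk_out (s := QuotientGroup.rightRel (Subgroup.zpowers γ)) g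
  have h := QuotientGroup.rightRel_apply.1 h
  have := inv_mem h
  simpa [cosetRep] using this

theorem cosetRep_eq (γ : G) {g h : G} (hgh : h * g⁻¹ ∈ Subgroup.zpowers γ) :
    cosetRep γ g = cosetRep γ h := by
  unfold cosetRep
  congr 1
  exact Quotient.sound (QuotientGroup.rightRel_apply.2 hgh)

open Classical in
/-- The restriction of an element of the group ring to the chosen coset representatives. -/
noncomputable def restrictReps (γ : G) : MonoidAlgebra ℤ G →+ MonoidAlgebra ℤ G where
  toFun z := .ofCoeff (z.coeff.filter fun g => g = cosetRep γ g)
  map_zero' := by ext; simp [Finsupp.filter_apply]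
  map_add' x y := by ext; simp [Finsupp.filter_add]

theorem of_pow_mul_coeff (γ : G) (z : MonoidAlgebra ℤ G) (j : ℕ) (g : G) :
    (MonoidAlgebra.of ℤ G γ ^ j * z).coeff g = z.coeff (γ⁻¹ ^ j * g) := by
  rw [← map_pow, MonoidAlgebra.of_apply, MonoidAlgebra.coeff_single_mul_apply, one_mul, inv_pow]

/-- A `γ`-invariant element has constant coefficients on each coset `⟨γ⟩ g`, so it is the norm times
its restriction to one representative per coset. This and the next lemma express that the Tate
cohomology of `⟨γ⟩` vanishes in the free `ℤ⟨γ⟩`-module `ℤG`. -/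
theorem exists_normElement_mul_of_sub_one_mul_eq_zero {γ : G} (hγ : 0 < orderOf γ)
    {z : MonoidAlgebra ℤ G} (hz : (MonoidAlgebra.of ℤ G γ - 1) * z = 0) :
    ∃ y, z = normElement γ * y := by
  classical
  have hz1 : MonoidAlgebra.of ℤ G γ * z = z := by
    rw [sub_mul, one_mul, sub_eq_zero] at hz; exact hz
  have hzj : ∀ j : ℕ, MonoidAlgebra.of ℤ G γ ^ j * z = z := by
    intro j
    induction j with
    | zero => simp
    | succ j ih => rw [pow_succ, mul_assoc, hz1, ih]
  refine ⟨restrictReps γ z, ?_⟩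
  ext g
  rw [normElement, Finset.sum_mul, MonoidAlgebra.coeff_sum, Finsupp.finsetSum_apply]
  have key : ∀ j ∈ Finset.range (orderOf γ),
      (MonoidAlgebra.of ℤ G γ ^ j * restrictReps γ z).coeff g =
        if γ⁻¹ ^ j * g = cosetRep γ g then z.coeff g else 0 := by
    intro j _
    rw [of_pow_mul_coeff]
    have h1 : cosetRep γ (γ⁻¹ ^ j * g) = cosetRep γ g := by
      apply cosetRep_eq
      have : g * (γ⁻¹ ^ j * g)⁻¹ = γ ^ j := by group
      rw [this]
      exact pow_mem (Subgroup.mem_zpowers γ) j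
    have h2 : z.coeff (γ⁻¹ ^ j * g) = z.coeff g := by
      rw [← of_pow_mul_coeff, hzj]
    change (z.coeff.filter fun g => g = cosetRep γ g) (γ⁻¹ ^ j * g) = _
    rw [Finsupp.filter_apply, h1, h2]
  rw [Finset.sum_congr rfl key, ← orderOf_inv γ, sum_ite_pow_mul_eq (by rwa [orderOf_inv])]
  rw [Subgroup.zpowers_inv]
  exact cosetRep_mul_inv_mem γ g

/-- Modulo `γ - 1` each group element `g` equals the representative `r` of its coset, since `g - r =
(γ ^ n - 1) r`, and this `r` is the restriction of `normElement γ * g`. -/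
theorem exists_sub_one_mul_of_normElement_mul_eq_zero {γ : G} (hγ : 0 < orderOf γ)
    {z : MonoidAlgebra ℤ G} (hz : normElement γ * z = 0) :
    ∃ y, z = (MonoidAlgebra.of ℤ G γ - 1) * y := by
  classical
  have key : ∀ x : MonoidAlgebra ℤ G,
      ∃ y, x - restrictReps γ (normElement γ * x) = (MonoidAlgebra.of ℤ G γ - 1) * y := by
    intro x
    induction x using MonoidAlgebra.induction_linear with
    | zero => exact ⟨0, by simp⟩
    | add x y hx hy =>
      obtain ⟨u, hu⟩ := hx
      obtain ⟨v, hv⟩ := hy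
      refine ⟨u + v, ?_⟩
      rw [mul_add, mul_add, ← hu, ← hv, map_add]
      abel
    | single g c =>
      have h1 : restrictReps γ (normElement γ * MonoidAlgebra.single g c) =
          MonoidAlgebra.single (cosetRep γ g) c := by
        rw [normElement, Finset.sum_mul, map_sum]
        rw [← sum_ite_pow_mul_eq hγ (cosetRep_mul_inv_mem γ g)
          (MonoidAlgebra.single (cosetRep γ g) c)]
        refine Finset.sum_congr rfl fun j _ => ?_
        rw [← map_pow, MonoidAlgebra.of_apply, MonoidAlgebra.single_mul_single, one_mul]
        have h1 : cosetRep γ (γ ^ j * g) = cosetRep γ g := by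
          apply cosetRep_eq
          have : g * (γ ^ j * g)⁻¹ = (γ ^ j)⁻¹ := by group
          rw [this]
          exact inv_mem (pow_mem (Subgroup.mem_zpowers γ) j)
        change MonoidAlgebra.ofCoeff ((Finsupp.single (γ ^ j * g) c).filter
          fun g => g = cosetRep γ g) = _
        split_ifs with h
        · rw [Finsupp.filter_single_of_pos _ (by rw [h1, h]), h]
          rfl
        · rw [Finsupp.filter_single_of_neg _ (by rw [h1]; exact h)]
          rfl
      rw [h1]
      have hfin : IsOfFinOrder γ := orderOf_pos_iff.1 hγ
      obtain ⟨n, hn⟩ := (hfin.mem_powers_iff_mem_zpowers.2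
        (by simpa using inv_mem (cosetRep_mul_inv_mem γ g)) :
          g * (cosetRep γ g)⁻¹ ∈ Submonoid.powers γ)
      have hn : γ ^ n = g * (cosetRep γ g)⁻¹ := hn
      refine ⟨(∑ j ∈ Finset.range n, MonoidAlgebra.of ℤ G γ ^ j) *
        MonoidAlgebra.single (cosetRep γ g) c, ?_⟩
      rw [← mul_assoc, mul_geom_sum, sub_mul, one_mul, ← map_pow, MonoidAlgebra.of_apply,
        MonoidAlgebra.single_mul_single, one_mul, hn, inv_mul_cancel_right]
  obtain ⟨y, hy⟩ := key z
  exact ⟨y, by rw [← hy, hz, map_zero, sub_zero]⟩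

/-- A finitely supported function invariant under a freely acting cyclic group of order `m` has sum
divisible by `m`. -/
theorem orderOf_dvd_sum_of_free {X : Type*} [MulAction G X] {γ : G} (hγ : 0 < orderOf γ)
    (hfree : ∀ (x : X) (h : G), h ∈ Subgroup.zpowers γ → h • x = x → h = 1) (f : X →₀ ℤ)
    (hf : ∀ x, f (γ • x) = f x) : (orderOf γ : ℤ) ∣ f.sum fun _ c => c := by
  classical
  let H := Subgroup.zpowers γ
  have hfH : ∀ h ∈ H, ∀ x, f (h • x) = f x := by
    intro h hh
    obtain ⟨n, rfl⟩ := ((orderOf_pos_iff.1 hγ).mem_powers_iff_mem_zpowers.2 hh :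
      h ∈ Submonoid.powers γ)
    intro x
    change f (γ ^ n • x) = f x
    induction n generalizing x with
    | zero => simp
    | succ n ih => rw [pow_succ, mul_smul, ih (pow_mem (Subgroup.mem_zpowers γ) _), hf]
  -- The sum is split over orbits. On each one `f` is constant, and by freeness an orbit meeting the
  -- support contributes exactly `orderOf γ` equal terms.
  let q : X → MulAction.orbitRel.Quotient H X := Quotient.mk _
  rw [Finsupp.sum, ← Finset.sum_fiberwise_of_maps_to
    (fun x hx => Finset.mem_image_of_mem q hx : ∀ x ∈ f.support, q x ∈ f.support.image q)]
  refine Finset.dvd_sum fun c hc => ?_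
  obtain ⟨x, hx, rfl⟩ := Finset.mem_image.1 hc
  have h1 : ∀ y ∈ f.support.filter (fun y => q y = q x), f y = f x := by
    intro y hy
    obtain ⟨h, hh⟩ := Quotient.exact (Finset.mem_filter.1 hy).2
    rw [← hh]
    exact hfH h h.2 x
  rw [Finset.sum_congr rfl h1, Finset.sum_const, nsmul_eq_mul]
  refine Dvd.dvd.mul_right ?_ _
  have h2 : (f.support.filter (fun y => q y = q x)).card = Nat.card H := by
    have : Finite H := by
      apply Nat.finite_of_card_ne_zero
      rw [Nat.card_zpowers]; exact hγ.ne'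
    rw [← Set.ncard_coe_finset, ← Nat.card_coe_set_eq]
    have hmem : ∀ h : H, h • x ∈ f.support.filter (fun y => q y = q x) := by
      intro h
      refine Finset.mem_filter.2 ⟨?_, Quotient.sound ⟨h, rfl⟩⟩
      rw [Finsupp.mem_support_iff] at hx ⊢
      rw [Subgroup.smul_def, hfH h h.2]
      exact hx
    refine (Nat.card_eq_of_bijective (fun h : H => ⟨h • x, hmem h⟩) ⟨?_, ?_⟩).symm
    · intro h h' hhh
      have hhh : (h : G) • x = (h' : G) • x := congrArg Subtype.val hhh
      have := hfree x ((h' : G)⁻¹ * h) (mul_mem (inv_mem h'.2) h.2) (by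
        rw [mul_smul, hhh, inv_smul_smul])
      exact Subtype.ext (inv_mul_eq_one.1 this).symm
    · rintro ⟨y, hy⟩
      obtain ⟨h, hh⟩ := Quotient.exact (Finset.mem_filter.1 hy).2
      exact ⟨h, Subtype.ext hh⟩
  rw [h2, Nat.card_zpowers]

end FreeCyclicAction

/-! ### Fox derivations with values in a module over the group ring. -/

section FoxCalculus

variable {α G M M' : Type*} [Group G] [AddCommGroup M] [Module (MonoidAlgebra ℤ G) M]
  [AddCommGroup M'] [Module (MonoidAlgebra ℤ G) M']

/-- The affine permutation `m ↦ g m + d` of a module over the integral group ring. -/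
noncomputable def affinePerm (g : G) (d : M) : Equiv.Perm M where
  toFun m := MonoidAlgebra.of ℤ G g • m + d
  invFun m := MonoidAlgebra.of ℤ G g⁻¹ • (m - d)
  left_inv m := by
    change MonoidAlgebra.of ℤ G g⁻¹ • (MonoidAlgebra.of ℤ G g • m + d - d) = m
    rw [add_sub_cancel_right, smul_smul, ← map_mul, inv_mul_cancel, map_one, one_smul]
  right_inv m := by
    change MonoidAlgebra.of ℤ G g • (MonoidAlgebra.of ℤ G g⁻¹ • (m - d)) + d = m
    rw [smul_smul, ← map_mul, mul_inv_cancel, map_one, one_smul, sub_add_cancel]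

variable (π : FreeGroup α →* G) (d : α → M)

/-- The action of the free group by affine permutations attached to a Fox derivation. -/
noncomputable def foxPerm : FreeGroup α →* Equiv.Perm M :=
  FreeGroup.lift fun a => affinePerm (π (FreeGroup.of a)) (d a)

/-- The derivation of the free group with prescribed values on the generators. -/
noncomputable def foxDer (u : FreeGroup α) : M := foxPerm π d u 0

/-- The derivation is the translation part of a homomorphism into affine permutations, so its
existence is the universal property of the free group and the Leibniz rule is composition. -/
theorem foxPerm_apply (u : FreeGroup α) (m : M) :
    foxPerm π d u m = MonoidAlgebra.of ℤ G (π u) • m + foxDer π d u := by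
  induction u using FreeGroup.induction_on generalizing m with
  | C1 => simp only [foxDer, map_one, Equiv.Perm.one_apply, one_smul, add_zero]
  | of a =>
    simp only [foxDer, foxPerm, FreeGroup.lift_apply_of]
    change MonoidAlgebra.of ℤ G (π (FreeGroup.of a)) • m + d a =
      MonoidAlgebra.of ℤ G (π (FreeGroup.of a)) • m +
        (MonoidAlgebra.of ℤ G (π (FreeGroup.of a)) • 0 + d a)
    rw [smul_zero, zero_add]
  | inv_of a _ =>
    simp only [foxDer, foxPerm, FreeGroup.lift_apply_of, map_inv]
    change MonoidAlgebra.of ℤ G (π (FreeGroup.of a))⁻¹ • (m - d a) =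
      MonoidAlgebra.of ℤ G (π (FreeGroup.of a))⁻¹ • m +
        (MonoidAlgebra.of ℤ G (π (FreeGroup.of a))⁻¹ • (0 - d a))
    rw [smul_sub, zero_sub, smul_neg, sub_eq_add_neg]
  | mul u v hu hv =>
    have h : foxDer π d (u * v) = foxPerm π d u (foxDer π d v) := by
      rw [foxDer, map_mul]; rfl
    rw [h, map_mul, Equiv.Perm.mul_apply, hv, hu, hu (foxDer π d v), map_mul, map_mul, smul_add,
      smul_smul, add_assoc]

theorem foxDer_one : foxDer π d 1 = 0 := by simp [foxDer]

theorem foxDer_of (a : α) : foxDer π d (FreeGroup.of a) = d a := by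
  simp only [foxDer, foxPerm, FreeGroup.lift_apply_of]
  change MonoidAlgebra.of ℤ G (π (FreeGroup.of a)) • (0 : M) + d a = d a
  rw [smul_zero, zero_add]

theorem foxDer_mul (u v : FreeGroup α) :
    foxDer π d (u * v) = foxDer π d u + MonoidAlgebra.of ℤ G (π u) • foxDer π d v := by
  rw [foxDer, map_mul, Equiv.Perm.mul_apply, foxPerm_apply, add_comm]
  rfl

theorem foxDer_inv (u : FreeGroup α) :
    foxDer π d u⁻¹ = -(MonoidAlgebra.of ℤ G (π u)⁻¹ • foxDer π d u) := by
  have h := foxDer_mul π d u⁻¹ u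
  rw [inv_mul_cancel, foxDer_one, map_inv] at h
  exact eq_neg_of_add_eq_zero_left h.symm

theorem map_foxDer (f : M →ₗ[MonoidAlgebra ℤ G] M') (u : FreeGroup α) :
    f (foxDer π d u) = foxDer π (fun a => f (d a)) u := by
  induction u using FreeGroup.induction_on with
  | C1 => simp [foxDer_one]
  | of a => simp only [foxDer_of]
  | inv_of a h => rw [foxDer_inv, foxDer_inv, map_neg, map_smul, h]
  | mul u v hu hv => rw [foxDer_mul, foxDer_mul, map_add, map_smul, hu, hv]

/-- The map `u ↦ π u - 1` is itself a derivation. With `map_foxDer` this yields the fundamental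
formula `∑ (∂u/∂a)(a - 1) = u - 1`. -/
theorem foxDer_sub_one (u : FreeGroup α) :
    foxDer π (fun a => MonoidAlgebra.of ℤ G (π (FreeGroup.of a)) - 1) u =
      MonoidAlgebra.of ℤ G (π u) - 1 := by
  induction u using FreeGroup.induction_on with
  | C1 => rw [foxDer_one, map_one, map_one, sub_self]
  | of a => simp only [foxDer_of]
  | inv_of a h =>
    rw [foxDer_inv, h, smul_eq_mul, mul_sub, ← map_mul, inv_mul_cancel, map_one, mul_one, map_inv π,
      neg_sub]
  | mul u v hu hv =>
    rw [foxDer_mul, hu, hv, smul_eq_mul, mul_sub, mul_one, map_mul, map_mul]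
    abel

/-- A derivation that is principal at `a` stays so on powers of `a`. It therefore vanishes on the
relator `xᵢ ^ νᵢ`, whose image is `1`. -/
theorem foxDer_pow_of_eq_one_sub_smul (a : α) (c : M)
    (h : d a = (1 - MonoidAlgebra.of ℤ G (π (FreeGroup.of a))) • c) (n : ℕ) :
    foxDer π d (FreeGroup.of a ^ n) =
      (1 - MonoidAlgebra.of ℤ G (π (FreeGroup.of a ^ n))) • c := by
  induction n with
  | zero => rw [pow_zero, foxDer_one, map_one, map_one, sub_self, zero_smul]
  | succ n ih =>
    rw [pow_succ, foxDer_mul, ih, foxDer_of, h, smul_smul, ← add_smul, map_mul, map_mul]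
    congr 1
    rw [mul_sub, mul_one]
    abel

theorem foxDer_list_prod_eq_zero (l : List (FreeGroup α)) (h : ∀ u ∈ l, foxDer π d u = 0) :
    foxDer π d l.prod = 0 := by
  induction l with
  | nil => simp [foxDer_one]
  | cons u l ih =>
    rw [List.prod_cons, foxDer_mul, h u (by simp), ih fun v hv => h v (by simp [hv])]
    simp

/-- Only the factor `j` contributes, translated by the prefix before it. This reads off single
coordinates of the polygon boundary. -/
theorem foxDer_prod_ofFn {n : ℕ} (l : Fin n → FreeGroup α) (j : Fin n)
    (h : ∀ i, i ≠ j → foxDer π d (l i) = 0) :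
    foxDer π d (List.ofFn l).prod =
      MonoidAlgebra.of ℤ G (π ((List.ofFn l).take j).prod) • foxDer π d (l j) := by
  have hlen : (j : ℕ) < (List.ofFn l).length := by simp
  have hget : ∀ (i : ℕ) (hi : i < (List.ofFn l).length),
      i ≠ j → foxDer π d (List.ofFn l)[i] = 0 := by
    intro i hi hij
    rw [List.getElem_ofFn]
    exact h _ fun h' => hij (by rw [← h'])
  have hsplit : (List.ofFn l).prod = ((List.ofFn l).take j).prod *
      (l j * ((List.ofFn l).drop (j + 1)).prod) := by
    conv_lhs => rw [← List.take_append_drop j (List.ofFn l), List.drop_eq_getElem_cons hlen]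
    simp
  rw [hsplit, foxDer_mul, foxDer_mul, foxDer_list_prod_eq_zero _ _ (List.take _ _),
    foxDer_list_prod_eq_zero _ _ (List.drop _ _)]
  · simp
  · intro u hu
    obtain ⟨i, hi, rfl⟩ := List.mem_iff_getElem.1 hu
    rw [List.getElem_drop]
    exact hget _ _ (by omega)
  · intro u hu
    obtain ⟨i, hi, rfl⟩ := List.mem_iff_getElem.1 hu
    rw [List.getElem_take]
    rw [List.length_take] at hi
    exact hget _ _ (by omega)

end FoxCalculus

/-! ### Exactness in degree one for a presented group. -/

section PresentedGroup

variable {α M : Type*} {rels : Set (FreeGroup α)} [AddCommGroup M]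
  [Module (MonoidAlgebra ℤ (PresentedGroup rels)) M]

/-- A Fox derivation vanishing on the relators descends to the presented group. -/
theorem foxDer_eq_of_mk_eq {d : α → M} (hd : ∀ r ∈ rels, foxDer (PresentedGroup.mk rels) d r = 0)
    {u v : FreeGroup α} (h : PresentedGroup.mk rels u = PresentedGroup.mk rels v) :
    foxDer (PresentedGroup.mk rels) d u = foxDer (PresentedGroup.mk rels) d v := by
  have h1 : ∀ r ∈ rels, foxPerm (PresentedGroup.mk rels) d r = 1 := by
    intro r hr
    ext m
    rw [foxPerm_apply, hd r hr, PresentedGroup.one_of_mem hr, map_one, one_smul, add_zero]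
    rfl
  have h2 : ∀ u, PresentedGroup.toGroup h1 (PresentedGroup.mk rels u) =
      foxPerm (PresentedGroup.mk rels) d u := fun u => rfl
  rw [foxDer, foxDer, ← h2, ← h2, h]

/-- Exactness of the relation sequence: a relation `∑ yₐ (a - 1) = 0` in the group ring is a
consequence of the relators. -/
theorem linearCombination_mem_of_sub_one_eq_zero {d : α → M}
    {N : Submodule (MonoidAlgebra ℤ (PresentedGroup rels)) M}
    (hd : ∀ r ∈ rels, foxDer (PresentedGroup.mk rels) d r ∈ N)
    (y : α →₀ MonoidAlgebra ℤ (PresentedGroup rels))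
    (hy : Finsupp.linearCombination (MonoidAlgebra ℤ (PresentedGroup rels))
      (fun a => MonoidAlgebra.of ℤ (PresentedGroup rels) (PresentedGroup.of a) - 1) y = 0) :
    Finsupp.linearCombination (MonoidAlgebra ℤ (PresentedGroup rels)) d y ∈ N := by
  let π := PresentedGroup.mk rels
  -- Modulo `N` the derivation kills the relators, so it descends to a crossed homomorphism `D` on
  -- the group. For its additive extension `S`, the identity `D (h a) - D h = h • d' a` gives `S (r
  -- (a - 1)) = r • d' a`. Applying `S` to the relation `hy` gives the claim.
  let d' : α → M ⧸ N := fun a => N.mkQ (d a)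
  have hd' : ∀ r ∈ rels, foxDer π d' r = 0 := by
    intro r hr
    rw [← map_foxDer]
    exact (Submodule.Quotient.mk_eq_zero N).2 (hd r hr)
  let D : PresentedGroup rels → M ⧸ N := fun h =>
    foxDer π d' (PresentedGroup.mk_surjective rels h).choose
  have hD : ∀ u, D (π u) = foxDer π d' u := fun u =>
    foxDer_eq_of_mk_eq hd' (PresentedGroup.mk_surjective rels (π u)).choose_spec
  let S : MonoidAlgebra ℤ (PresentedGroup rels) →+ M ⧸ N :=
    ((Finsupp.linearCombination ℤ D).toAddMonoidHom).comp
      { toFun := MonoidAlgebra.coeff, map_zero' := rfl, map_add' := fun _ _ => rfl }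
  have hS : ∀ h c, S (MonoidAlgebra.single h c) = c • D h := fun h c =>
    Finsupp.linearCombination_single ℤ c h
  have hS2 : ∀ (r : MonoidAlgebra ℤ (PresentedGroup rels)) (a : α),
      S (r * (MonoidAlgebra.of ℤ (PresentedGroup rels) (PresentedGroup.of a) - 1)) =
        r • d' a := by
    intro r a
    induction r using MonoidAlgebra.induction_linear with
    | zero => simp
    | add r s hr hs => rw [add_mul, map_add, hr, hs, add_smul]
    | single h c =>
      rw [mul_sub, mul_one, map_sub, MonoidAlgebra.of_apply, MonoidAlgebra.single_mul_single,
        mul_one, hS, hS]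
      obtain ⟨u, rfl⟩ := PresentedGroup.mk_surjective rels h
      have h1 : D (PresentedGroup.mk rels u * PresentedGroup.of a) =
          D (PresentedGroup.mk rels u) + MonoidAlgebra.of ℤ (PresentedGroup rels)
            (PresentedGroup.mk rels u) • d' a := by
        have : PresentedGroup.mk rels u * PresentedGroup.of a = π (u * FreeGroup.of a) := by
          rw [map_mul]; rfl
        rw [this, hD, foxDer_mul, foxDer_of]
        congr 1
        exact (hD u).symm
      rw [h1, smul_add, add_sub_cancel_left]
      have h2 : MonoidAlgebra.single (PresentedGroup.mk rels u) c =
          c • MonoidAlgebra.of ℤ (PresentedGroup rels) (PresentedGroup.mk rels u) := by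
        rw [MonoidAlgebra.of_apply, MonoidAlgebra.smul_single, smul_eq_mul, mul_one]
      rw [h2, smul_assoc]
  have hfin : N.mkQ (Finsupp.linearCombination (MonoidAlgebra ℤ (PresentedGroup rels)) d y) = 0 := by
    rw [← map_zero S, ← hy, Finsupp.linearCombination_apply, Finsupp.linearCombination_apply,
      Finsupp.sum, Finsupp.sum, map_sum, map_sum]
    refine Finset.sum_congr rfl fun a _ => ?_
    rw [smul_eq_mul, hS2, map_smul]
  exact (Submodule.Quotient.mk_eq_zero N).1 hfin

end PresentedGroup

/-! ### The fundamental polygon and injectivity of its boundary map. -/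

section FuchsianPresentation

/-- Invariance makes all coefficients equal, and finite support in an infinite group leaves one of
them zero. -/
theorem eq_zero_of_forall_mul_of_eq {G : Type*} [Group G] [Infinite G] {z : MonoidAlgebra ℤ G}
    (h : ∀ s : G, z * MonoidAlgebra.of ℤ G s = z) : z = 0 := by
  ext g
  obtain ⟨g', hg'⟩ := Infinite.exists_notMem_finset z.coeff.support
  have h1 := congrArg (fun y => y.coeff g) (h (g'⁻¹ * g))
  simp only [MonoidAlgebra.of_apply, MonoidAlgebra.coeff_mul_single_apply, mul_one] at h1
  have h2 : g * (g'⁻¹ * g)⁻¹ = g' := by group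
  rw [h2, Finsupp.notMem_support_iff.1 hg'] at h1
  rw [← h1]
  rfl

/-- The stabilizer of an element of the group ring under right multiplication. -/
def rightStabilizer {G : Type*} [Group G] (z : MonoidAlgebra ℤ G) : Subgroup G where
  carrier := {s | z * MonoidAlgebra.of ℤ G s = z}
  one_mem' := by
    change z * MonoidAlgebra.of ℤ G 1 = z
    rw [map_one, mul_one]
  mul_mem' {a b} ha hb := by
    change z * MonoidAlgebra.of ℤ G (a * b) = z
    rw [map_mul, ← mul_assoc, show z * MonoidAlgebra.of ℤ G a = z from ha]
    exact hb
  inv_mem' {a} ha := by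
    change z * MonoidAlgebra.of ℤ G a⁻¹ = z
    have ha : z * MonoidAlgebra.of ℤ G a = z := ha
    conv_lhs => rw [← ha]
    rw [mul_assoc, ← map_mul, mul_inv_cancel, map_one, mul_one]

theorem mul_inv_mem_rightStabilizer {G : Type*} [Group G] {z : MonoidAlgebra ℤ G} {a b : G}
    (h : z * MonoidAlgebra.of ℤ G a = z * MonoidAlgebra.of ℤ G b) :
    a * b⁻¹ ∈ rightStabilizer z := by
  change z * MonoidAlgebra.of ℤ G (a * b⁻¹) = z
  rw [map_mul, ← mul_assoc, h, mul_assoc, ← map_mul, mul_inv_cancel, map_one, mul_one]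

theorem map_take_prod_mem {F G : Type*} [Group F] [Group G] (π : F →* G) (S : Subgroup G)
    {n : ℕ} (l : Fin n → F) (m : ℕ) (h : ∀ i : Fin n, (i : ℕ) < m → π (l i) ∈ S) :
    π ((List.ofFn l).take m).prod ∈ S := by
  rw [map_list_prod]
  refine list_prod_mem fun x hx => ?_
  obtain ⟨u, hu, rfl⟩ := List.mem_map.1 hx
  obtain ⟨i, hi, rfl⟩ := List.mem_iff_getElem.1 hu
  rw [List.length_take, lt_min_iff] at hi
  rw [List.getElem_take, List.getElem_ofFn]
  exact h _ hi.1

/-- Each of the two letters labels two sides of the commutator, with opposite orientations. The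
derivative is thus a difference of two group elements, and an element annihilating it is invariant
under the corresponding side pairing. -/
theorem foxDer_commutator_of_right_eq_zero {α G : Type*} [Group G] (π : FreeGroup α →* G)
    (d : α → MonoidAlgebra ℤ G) {u v : FreeGroup α} (hu : foxDer π d u = 1)
    (hv : foxDer π d v = 0) :
    foxDer π d (u⁻¹ * v⁻¹ * u * v) = MonoidAlgebra.of ℤ G ((π u)⁻¹ * (π v)⁻¹) -
      MonoidAlgebra.of ℤ G (π u)⁻¹ := by
  rw [foxDer_mul, foxDer_mul, foxDer_mul, foxDer_inv, foxDer_inv, hu, hv, smul_zero, smul_zero,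
    neg_zero, smul_zero, add_zero, add_zero, smul_eq_mul, smul_eq_mul, mul_one, mul_one,
    map_mul π, map_inv π, map_inv π]
  abel

theorem foxDer_commutator_of_left_eq_zero {α G : Type*} [Group G] (π : FreeGroup α →* G)
    (d : α → MonoidAlgebra ℤ G) {u v : FreeGroup α} (hu : foxDer π d u = 0)
    (hv : foxDer π d v = 1) :
    foxDer π d (u⁻¹ * v⁻¹ * u * v) = MonoidAlgebra.of ℤ G ((π u)⁻¹ * (π v)⁻¹ * π u) -
      MonoidAlgebra.of ℤ G ((π u)⁻¹ * (π v)⁻¹) := by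
  rw [foxDer_mul, foxDer_mul, foxDer_mul, foxDer_inv, foxDer_inv, hu, hv, smul_zero, smul_zero,
    neg_zero, zero_add, add_zero, smul_neg, smul_smul, ← map_mul, smul_eq_mul, smul_eq_mul,
    mul_one, mul_one, map_mul π, map_mul π, map_inv π, map_inv π]
  abel

/-- Conjugating by `P` leaves `u = A⁻¹B⁻¹A` and `v = A⁻¹B⁻¹ABA` in `S`. Then `u⁻¹v = BA` and `BA·u =
A`. -/
theorem mem_of_conj_side_pairings {G : Type*} [Group G] {S : Subgroup G} {P A B : G} (hP : P ∈ S)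
    (h1 : P * (A⁻¹ * B⁻¹) * (P * A⁻¹)⁻¹ ∈ S)
    (h2 : P * (A⁻¹ * B⁻¹ * A) * (P * (A⁻¹ * B⁻¹))⁻¹ ∈ S) : A ∈ S ∧ B ∈ S := by
  have hu : A⁻¹ * B⁻¹ * A ∈ S := by
    have := mul_mem (mul_mem (inv_mem hP) h1) hP
    convert this using 1
    group
  have hv : A⁻¹ * B⁻¹ * A * B * A ∈ S := by
    have := mul_mem (mul_mem (inv_mem hP) h2) hP
    convert this using 1
    group
  have hBA : B * A ∈ S := by
    have := mul_mem (inv_mem hu) hv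
    convert this using 1
    group
  have hA : A ∈ S := by
    have := mul_mem hBA hu
    convert this using 1
    group
  exact ⟨hA, (mul_mem_cancel_right hA).1 hBA⟩

open FuchsianGen

variable {g k : ℕ} {ν : Fin k → ℕ}

/-- Cell-attaching data: the loop `aⱼ` or `bⱼ` is an edge, while `xᵢ` runs along the edge to the
`i`-th cone point and back along its rotate by `xᵢ`. -/
noncomputable def conePath (ν : Fin k → ℕ) (e : FuchsianGen g k) :
    FuchsianGen g k →₀ MonoidAlgebra ℤ (PresentedGroup (fuchsianRels g ν)) :=
  match e with
  | a j => Finsupp.single (a j) 1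
  | b j => Finsupp.single (b j) 1
  | x i => Finsupp.single (x i)
      (1 - MonoidAlgebra.of ℤ _ (PresentedGroup.of (x i)))

/-- The boundary of the fundamental polygon. -/
noncomputable def polygonBoundary (g : ℕ) {k : ℕ} (ν : Fin k → ℕ) :
    FuchsianGen g k →₀ MonoidAlgebra ℤ (PresentedGroup (fuchsianRels g ν)) :=
  foxDer (PresentedGroup.mk (fuchsianRels g ν)) (conePath ν) (fuchsianLongWord g k)

theorem of_pow_period (i : Fin k) :
    PresentedGroup.mk (fuchsianRels g ν) (FreeGroup.of (x i) ^ ν i) = 1 :=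
  PresentedGroup.one_of_mem (Or.inl ⟨i, rfl⟩)

theorem foxDer_conePath_mem_span (r : FreeGroup (FuchsianGen g k)) (hr : r ∈ fuchsianRels g ν) :
    foxDer (PresentedGroup.mk (fuchsianRels g ν)) (conePath ν) r ∈
      Submodule.span (MonoidAlgebra ℤ (PresentedGroup (fuchsianRels g ν)))
        {polygonBoundary g ν} := by
  rcases hr with ⟨i, rfl⟩ | hr
  · simp only
    rw [foxDer_pow_of_eq_one_sub_smul _ _ (x i) (Finsupp.single (x i) 1), of_pow_period, map_one,
      sub_self, zero_smul]
    · exact Submodule.zero_mem _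
    · rw [Finsupp.smul_single, smul_eq_mul, mul_one]
      rfl
  · rw [Set.mem_singleton_iff.1 hr]
    exact Submodule.mem_span_singleton_self _

theorem smul_foxDer_conePath_apply (z : MonoidAlgebra ℤ (PresentedGroup (fuchsianRels g ν)))
    (u : FreeGroup (FuchsianGen g k)) (e : FuchsianGen g k) :
    (z • foxDer (PresentedGroup.mk (fuchsianRels g ν)) (conePath ν) u) e =
      z * foxDer (PresentedGroup.mk (fuchsianRels g ν)) (fun e' => conePath ν e' e) u := by
  rw [Finsupp.smul_apply, smul_eq_mul]
  congr 1
  exact map_foxDer _ _ (Finsupp.lapply e) u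

/-- The boundary map in degree two is injective when the group is infinite. -/
theorem eq_zero_of_smul_polygonBoundary [Infinite (PresentedGroup (fuchsianRels g ν))]
    {z : MonoidAlgebra ℤ (PresentedGroup (fuchsianRels g ν))}
    (hz : z • polygonBoundary g ν = 0) : z = 0 := by
  classical
  let π := PresentedGroup.mk (fuchsianRels g ν)
  -- Geometrically, `z` takes equal values on polygons sharing a side: each coordinate of `z • w =
  -- 0`, with `w` the polygon boundary, puts one side pairing, conjugated by a prefix `P` of the
  -- long word, into `S`. Induction along the word gives `P ∈ S`, so every generator lies in `S`.
  let S := rightStabilizer z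
  have hcomp : ∀ e, z * foxDer π (fun e' => conePath ν e' e) (fuchsianLongWord g k) = 0 := by
    intro e
    rw [← smul_foxDer_conePath_apply]
    change (z • polygonBoundary g ν) e = 0
    rw [hz]
    rfl
  let l : Fin k → FreeGroup (FuchsianGen g k) := fun i => FreeGroup.of (x i)
  let c : Fin g → FreeGroup (FuchsianGen g k) := fun j =>
      (FreeGroup.of (FuchsianGen.a j))⁻¹ * (FreeGroup.of (FuchsianGen.b j))⁻¹ *
        FreeGroup.of (FuchsianGen.a j) * FreeGroup.of (FuchsianGen.b j)
  have hW : fuchsianLongWord g k = (List.ofFn l).prod * (List.ofFn c).prod := rfl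
  have hc0 : ∀ (e : FuchsianGen g k) (j : Fin g), e ≠ a j → e ≠ b j →
      foxDer π (fun e' => conePath ν e' e) (c j) = 0 := by
    intro e j ha hb
    have h1 : conePath (g := g) ν (a j) e = 0 := Finsupp.single_eq_of_ne ha
    have h2 : conePath (g := g) ν (b j) e = 0 := Finsupp.single_eq_of_ne hb
    simp only [c, foxDer_mul, foxDer_inv, foxDer_of, h1, h2, smul_zero, neg_zero, add_zero]
  have hl0 : ∀ (e : FuchsianGen g k) (i : Fin k), e ≠ x i →
      foxDer π (fun e' => conePath ν e' e) (l i) = 0 := by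
    intro e i hx
    rw [foxDer_of]
    exact Finsupp.single_eq_of_ne hx
  have hx : ∀ (m : ℕ) (i : Fin k), (i : ℕ) = m → π (l i) ∈ S := by
    intro m
    induction m using Nat.strong_induction_on with
    | _ m ih =>
    intro i him
    have h := hcomp (x i)
    rw [hW, foxDer_mul, foxDer_list_prod_eq_zero _ _ (List.ofFn c), smul_zero, add_zero,
      foxDer_prod_ofFn _ _ l i, foxDer_of] at h
    · have h1 : conePath (g := g) ν (x i) (x i) = 1 - MonoidAlgebra.of ℤ _ (π (l i)) :=
        Finsupp.single_eq_same
      rw [h1, smul_eq_mul, mul_sub, mul_one, ← map_mul, mul_sub, sub_eq_zero] at h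
      have h2 := mul_inv_mem_rightStabilizer h.symm
      have hP : π ((List.ofFn l).take i).prod ∈ S :=
        map_take_prod_mem π S l i fun i' hi' => ih i' (him ▸ hi') i' rfl
      have h3 := mul_mem (mul_mem (inv_mem hP) h2) hP
      convert h3 using 1
      group
    · intro i' hi'
      exact hl0 _ _ fun h' => hi' (by injection h'.symm)
    · intro u hu
      obtain ⟨j, rfl⟩ := (List.mem_ofFn' c u).1 hu
      exact hc0 _ _ (by simp) (by simp)
  have hl : π (List.ofFn l).prod ∈ S := by
    have := map_take_prod_mem π S l k fun i _ => hx i i rfl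
    rwa [List.take_of_length_le (by simp)] at this
  have hab : ∀ (m : ℕ) (j : Fin g), (j : ℕ) = m →
      π (FreeGroup.of (a j)) ∈ S ∧ π (FreeGroup.of (b j)) ∈ S := by
    intro m
    induction m using Nat.strong_induction_on with
    | _ m ih =>
    intro j hjm
    let P := π (List.ofFn l).prod * π ((List.ofFn c).take j).prod
    have hP : P ∈ S := by
      refine mul_mem hl (map_take_prod_mem π S c j fun j' hj' => ?_)
      obtain ⟨h1, h2⟩ := ih j' (hjm ▸ hj') j' rfl
      simp only [c, map_mul, map_inv]
      exact mul_mem (mul_mem (mul_mem (inv_mem h1) (inv_mem h2)) h1) h2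
    have hcomp' : ∀ e : FuchsianGen g k, (∀ i, e ≠ x i) → (∀ j', j' ≠ j → e ≠ a j' ∧ e ≠ b j') →
        z * (MonoidAlgebra.of ℤ _ P * foxDer π (fun e' => conePath ν e' e) (c j)) = 0 := by
      intro e he he'
      have h := hcomp e
      rw [hW, foxDer_mul, foxDer_list_prod_eq_zero _ _ (List.ofFn l), zero_add,
        foxDer_prod_ofFn _ _ c j, smul_smul, ← map_mul, smul_eq_mul] at h
      · exact h
      · intro j' hj'
        exact hc0 _ _ (he' j' hj').1 (he' j' hj').2
      · intro u hu
        obtain ⟨i, rfl⟩ := (List.mem_ofFn' l u).1 hu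
        exact hl0 _ _ (he i)
    set A := π (FreeGroup.of (a j)) with hA
    set B := π (FreeGroup.of (b j)) with hB
    have haa : foxDer π (fun e' => conePath ν e' (a j)) (FreeGroup.of (a j)) = 1 :=
      (foxDer_of _ _ _).trans Finsupp.single_eq_same
    have hbb : foxDer π (fun e' => conePath ν e' (b j)) (FreeGroup.of (b j)) = 1 :=
      (foxDer_of _ _ _).trans Finsupp.single_eq_same
    have hab : foxDer π (fun e' => conePath ν e' (b j)) (FreeGroup.of (a j)) = 0 :=
      (foxDer_of _ _ _).trans (Finsupp.single_eq_of_ne (by simp))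
    have hba : foxDer π (fun e' => conePath ν e' (a j)) (FreeGroup.of (b j)) = 0 :=
      (foxDer_of _ _ _).trans (Finsupp.single_eq_of_ne (by simp))
    have h1 := hcomp' (a j) (by simp) (fun j' hj' => ⟨by simp [hj'.symm], by simp⟩)
    have h2 := hcomp' (b j) (by simp) (fun j' hj' => ⟨by simp, by simp [hj'.symm]⟩)
    rw [foxDer_commutator_of_right_eq_zero _ _ haa hba, mul_sub, mul_sub, sub_eq_zero, ← map_mul,
      ← map_mul, ← hA, ← hB] at h1
    rw [foxDer_commutator_of_left_eq_zero _ _ hab hbb, mul_sub, mul_sub, sub_eq_zero, ← map_mul,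
      ← map_mul, ← hA, ← hB] at h2
    exact mem_of_conj_side_pairings hP (mul_inv_mem_rightStabilizer h1)
      (mul_inv_mem_rightStabilizer h2)
  have htop : S = ⊤ := by
    rw [eq_top_iff, ← PresentedGroup.closure_range_of, Subgroup.closure_le]
    rintro _ ⟨e, rfl⟩
    cases e with
    | a j => exact (hab j j rfl).1
    | b j => exact (hab j j rfl).2
    | x i => exact hx i i rfl
  refine eq_zero_of_forall_mul_of_eq fun s => ?_
  have : s ∈ S := htop ▸ Subgroup.mem_top s
  exact this

end FuchsianPresentation

/-! ### Elements of finite order, via free actions on the chain complex. -/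

section Torsion

theorem exists_sub_one_smul_of_normElement_smul_eq_zero {G α : Type*} [Group G] {γ : G}
    (hγ : 0 < orderOf γ) {f : α →₀ MonoidAlgebra ℤ G} (hf : normElement γ • f = 0) :
    ∃ y, f = (MonoidAlgebra.of ℤ G γ - 1) • y := by
  classical
  have h : ∀ e, ∃ y, f e = (MonoidAlgebra.of ℤ G γ - 1) * y := fun e =>
    exists_sub_one_mul_of_normElement_mul_eq_zero hγ (DFunLike.congr_fun hf e)
  choose y hy using h
  refine ⟨Finsupp.onFinset f.support (fun e => if f e = 0 then 0 else y e) (by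
    intro e he
    rw [Finsupp.mem_support_iff]
    intro h0
    exact he (if_pos h0)), ?_⟩
  ext1 e
  rw [Finsupp.smul_apply, Finsupp.onFinset_apply, smul_eq_mul]
  split_ifs with h0
  · rw [h0, mul_zero]
  · exact hy e

/-- The augmentation of the integral group ring. -/
noncomputable def augmentation (G : Type*) [Group G] : MonoidAlgebra ℤ G →ₐ[ℤ] ℤ :=
  MonoidAlgebra.lift ℤ ℤ G 1

theorem augmentation_of {G : Type*} [Group G] (g : G) :
    augmentation G (MonoidAlgebra.of ℤ G g) = 1 := by
  rw [augmentation, MonoidAlgebra.lift_of]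
  rfl

theorem augmentation_normElement {G : Type*} [Group G] (γ : G) :
    augmentation G (normElement γ) = orderOf γ := by
  simp only [normElement, map_sum, map_pow, augmentation_of, one_pow, Finset.sum_const,
    Finset.card_range, nsmul_eq_mul, mul_one]

/-- The projection from the group ring to the permutation module on the cosets of `⟨t⟩`. -/
noncomputable def cosetProj {G : Type*} [Group G] (t : G) :
    MonoidAlgebra ℤ G →+ (G ⧸ Subgroup.zpowers t →₀ ℤ) where
  toFun z := z.coeff.mapDomain QuotientGroup.mk
  map_zero' := Finsupp.mapDomain_zero
  map_add' _ _ := Finsupp.mapDomain_add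

theorem cosetProj_single {G : Type*} [Group G] (t g : G) (c : ℤ) :
    cosetProj t (MonoidAlgebra.single g c) = Finsupp.single (g : G ⧸ Subgroup.zpowers t) c :=
  Finsupp.mapDomain_single

/-- The elements `h t` and `h` lie in the same coset of `⟨t⟩`. -/
theorem cosetProj_mul_sub_one {G : Type*} [Group G] (t : G) (r : MonoidAlgebra ℤ G) :
    cosetProj t (r * (MonoidAlgebra.of ℤ G t - 1)) = 0 := by
  induction r using MonoidAlgebra.induction_linear with
  | zero => rw [zero_mul, map_zero]
  | add r s hr hs => rw [add_mul, map_add, hr, hs, add_zero]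
  | single h c =>
    rw [mul_sub, mul_one, map_sub, MonoidAlgebra.of_apply, MonoidAlgebra.single_mul_single,
      mul_one, cosetProj_single, cosetProj_single, sub_eq_zero]
    congr 1
    rw [QuotientGroup.eq]
    convert inv_mem (Subgroup.mem_zpowers t) using 1
    group

theorem cosetProj_of_mul {G : Type*} [Group G] (t γ : G) (z : MonoidAlgebra ℤ G) :
    cosetProj t (MonoidAlgebra.of ℤ G γ * z) =
      (cosetProj t z).mapDomain (fun y => γ • y) := by
  induction z using MonoidAlgebra.induction_linear with
  | zero => rw [mul_zero, map_zero, Finsupp.mapDomain_zero]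
  | add r s hr hs => rw [mul_add, map_add, map_add, hr, hs, Finsupp.mapDomain_add]
  | single h c =>
    rw [MonoidAlgebra.of_apply, MonoidAlgebra.single_mul_single, one_mul, cosetProj_single,
      cosetProj_single, Finsupp.mapDomain_single]
    rfl

theorem sum_cosetProj {G : Type*} [Group G] (t : G) (z : MonoidAlgebra ℤ G) :
    ((cosetProj t z).sum fun _ c => c) = augmentation G z := by
  induction z using MonoidAlgebra.induction_linear with
  | zero => rw [map_zero, map_zero, Finsupp.sum_zero_index]
  | add r s hr hs =>
    rw [map_add, map_add, ← hr, ← hs,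
      Finsupp.sum_add_index' (fun _ => rfl) (fun _ _ _ => rfl)]
  | single h c =>
    rw [cosetProj_single, Finsupp.sum_single_index rfl, augmentation, MonoidAlgebra.lift_single]
    simp

/-- If `⟨γ⟩` acts freely on the cosets of `⟨t⟩`, an element of the permutation module on these
cosets fixed by `γ` has augmentation divisible by the order of `γ`. -/
theorem orderOf_dvd_augmentation {G : Type*} [Group G] {γ t : G} (hγ : 0 < orderOf γ)
    (hfree : ∀ u, ∀ h ∈ Subgroup.zpowers γ, u⁻¹ * h * u ∈ Subgroup.zpowers t → h = 1)
    {z r : MonoidAlgebra ℤ G}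
    (hz : (MonoidAlgebra.of ℤ G γ - 1) * z = r * (MonoidAlgebra.of ℤ G t - 1)) :
    (orderOf γ : ℤ) ∣ augmentation G z := by
  rw [← sum_cosetProj t]
  refine orderOf_dvd_sum_of_free hγ ?_ _ ?_
  · intro y h hh hy
    induction y using QuotientGroup.induction_on with
    | H u =>
      refine hfree u h hh ?_
      have h1 : ((h * u : G) : G ⧸ Subgroup.zpowers t) = u := hy
      have h2 := inv_mem (QuotientGroup.eq.1 h1)
      convert h2 using 1
      group
  · intro y
    have h1 := congrArg (cosetProj t) hz
    rw [cosetProj_mul_sub_one, sub_mul, one_mul, map_sub, sub_eq_zero, cosetProj_of_mul] at h1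
    conv_lhs => rw [← h1]
    exact Finsupp.mapDomain_apply (MulAction.injective γ) _ y

open FuchsianGen

variable {g k : ℕ} {ν : Fin k → ℕ}

/-- The base vertex component of the boundary of a one-chain. -/
noncomputable def baseBoundary (g : ℕ) {k : ℕ} (ν : Fin k → ℕ) :
    (FuchsianGen g k →₀ MonoidAlgebra ℤ (PresentedGroup (fuchsianRels g ν)))
      →ₗ[MonoidAlgebra ℤ (PresentedGroup (fuchsianRels g ν))]
      MonoidAlgebra ℤ (PresentedGroup (fuchsianRels g ν)) :=
  Finsupp.linearCombination _ fun e => match e with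
    | a j => MonoidAlgebra.of ℤ _ (PresentedGroup.of (a j)) - 1
    | b j => MonoidAlgebra.of ℤ _ (PresentedGroup.of (b j)) - 1
    | x _ => -1

theorem baseBoundary_conePath (e : FuchsianGen g k) :
    baseBoundary g ν (conePath ν e) = MonoidAlgebra.of ℤ _ (PresentedGroup.of e) - 1 := by
  cases e with
  | a j => exact (Finsupp.linearCombination_single _ _ _).trans (one_smul _ _)
  | b j => exact (Finsupp.linearCombination_single _ _ _).trans (one_smul _ _)
  | x i =>
    refine (Finsupp.linearCombination_single _ _ _).trans ?_
    rw [smul_eq_mul, mul_neg, mul_one, neg_sub]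

theorem baseBoundary_foxDer (u : FreeGroup (FuchsianGen g k)) :
    baseBoundary g ν (foxDer (PresentedGroup.mk (fuchsianRels g ν)) (conePath ν) u) =
      MonoidAlgebra.of ℤ _ (PresentedGroup.mk (fuchsianRels g ν) u) - 1 := by
  rw [map_foxDer, ← foxDer_sub_one]
  congr 1
  funext e
  exact baseBoundary_conePath e

/-- A path made of generator loops runs to a cone point and back, so it has no boundary there: its
coordinate dies in `ℤ[G/⟨xᵢ⟩]`. -/
theorem foxDer_conePath_apply_x (u : FreeGroup (FuchsianGen g k)) (i : Fin k) :
    ∃ r, foxDer (PresentedGroup.mk (fuchsianRels g ν)) (conePath ν) u (x i) =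
      r * (MonoidAlgebra.of ℤ _ (PresentedGroup.of (x i)) - 1) := by
  let π := PresentedGroup.mk (fuchsianRels g ν)
  induction u using FreeGroup.induction_on with
  | C1 => exact ⟨0, by rw [foxDer_one, zero_mul]; rfl⟩
  | of e =>
    rw [foxDer_of]
    by_cases h : x i = e
    · subst h
      refine ⟨-1, ?_⟩
      rw [neg_one_mul, neg_sub]
      exact Finsupp.single_eq_same
    · refine ⟨0, ?_⟩
      rw [zero_mul]
      cases e <;> exact Finsupp.single_eq_of_ne h
  | inv_of e h =>
    obtain ⟨r, hr⟩ := h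
    refine ⟨-(MonoidAlgebra.of ℤ _ (π (FreeGroup.of e))⁻¹ * r), ?_⟩
    rw [foxDer_inv, Finsupp.neg_apply, Finsupp.smul_apply, hr, smul_eq_mul, neg_mul, mul_assoc]
  | mul u v hu hv =>
    obtain ⟨r, hr⟩ := hu
    obtain ⟨s, hs⟩ := hv
    refine ⟨r + MonoidAlgebra.of ℤ _ (π u) * s, ?_⟩
    rw [foxDer_mul, Finsupp.add_apply, Finsupp.smul_apply, hr, hs, smul_eq_mul, add_mul, mul_assoc]

/-- Every derivation factors through the universal one, whose coordinates are the Fox derivatives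
`∂u/∂a`. -/
theorem linearCombination_foxDer_single {α G M : Type*} [Group G] [AddCommGroup M]
    [Module (MonoidAlgebra ℤ G) M] (π : FreeGroup α →* G) (d : α → M) (u : FreeGroup α) :
    Finsupp.linearCombination (MonoidAlgebra ℤ G) d
      (foxDer π (fun a => Finsupp.single a 1) u) = foxDer π d u := by
  rw [map_foxDer]
  congr 1
  funext a
  rw [Finsupp.linearCombination_single, one_smul]

/-- Torsion theorem for infinite groups with a Fuchsian presentation: a nontrivial element of finite
order cannot generate a cyclic group acting freely on the cosets of all the `⟨xᵢ⟩`. -/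
theorem orderOf_eq_one_of_free [Infinite (PresentedGroup (fuchsianRels g ν))]
    {γ : PresentedGroup (fuchsianRels g ν)} (hγ : 0 < orderOf γ)
    (hfree : ∀ i u, ∀ h ∈ Subgroup.zpowers γ,
      u⁻¹ * h * u ∈ Subgroup.zpowers (PresentedGroup.of (x i)) → h = 1) : orderOf γ = 1 := by
  let π := PresentedGroup.mk (fuchsianRels g ν)
  obtain ⟨u, hu⟩ := PresentedGroup.mk_surjective (fuchsianRels g ν) γ
  set τ := MonoidAlgebra.of ℤ _ γ - 1 with hτ
  let w := polygonBoundary g ν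
  -- The chain of a path from the base vertex to its translate by `γ`. Its norm is a cycle, hence by
  -- exactness a multiple `z • w` of the polygon boundary.
  let e₁ := foxDer π (conePath ν) u
  have h1 : normElement γ • e₁ ∈ Submodule.span (MonoidAlgebra ℤ (PresentedGroup (fuchsianRels g ν))) {w} := by
    have := linearCombination_mem_of_sub_one_eq_zero (foxDer_conePath_mem_span (g := g) (ν := ν))
      (normElement γ • foxDer π (fun a => Finsupp.single a 1) u) (by
        have h := linearCombination_foxDer_single π
          (fun e => MonoidAlgebra.of ℤ _ (π (FreeGroup.of e)) - 1) u
        rw [foxDer_sub_one, hu] at h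
        rw [map_smul]
        exact (congrArg (normElement γ • ·) h).trans (normElement_mul_sub_one γ))
    rwa [map_smul, linearCombination_foxDer_single] at this
  obtain ⟨z, hz⟩ := Submodule.mem_span_singleton.1 h1
  -- The element `τ = γ - 1` kills the norm, and injectivity of the boundary map carries this over
  -- to `z`. So `z` is itself a norm, and subtracting `z' • w` from the path leaves a chain of norm
  -- zero.
  have h2 : τ * z = 0 := by
    apply eq_zero_of_smul_polygonBoundary (g := g) (ν := ν)
    rw [mul_smul]
    change τ • z • w = 0
    rw [hz, smul_smul, hτ, sub_one_mul_normElement, zero_smul]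
  obtain ⟨z', rfl⟩ := exists_normElement_mul_of_sub_one_mul_eq_zero hγ h2
  obtain ⟨f, hf⟩ : ∃ f, e₁ - z' • w = τ • f := by
    apply exists_sub_one_smul_of_normElement_smul_eq_zero hγ
    rw [smul_sub, smul_smul, hz, sub_self]
  have hW : π (fuchsianLongWord g k) = 1 := PresentedGroup.one_of_mem (Or.inr rfl)
  have hBw : baseBoundary g ν w = 0 := by
    have := baseBoundary_foxDer (g := g) (ν := ν) (fuchsianLongWord g k)
    rw [show PresentedGroup.mk (fuchsianRels g ν) (fuchsianLongWord g k) = 1 from hW, map_one,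
      sub_self] at this
    exact this
  have hB : τ * (1 - baseBoundary g ν f) = 0 := by
    have h := congrArg (baseBoundary g ν) hf
    rw [map_sub, map_smul, map_smul, hBw, smul_zero, sub_zero] at h
    have h' : baseBoundary g ν e₁ = τ := by
      rw [baseBoundary_foxDer, hu]
    rw [h', smul_eq_mul] at h
    rw [mul_sub, mul_one, ← h, sub_self]
  obtain ⟨y, hy⟩ := exists_normElement_mul_of_sub_one_mul_eq_zero hγ hB
  -- The `xᵢ`-coordinates of both `e₁` and `w` vanish in `ℤ[G/⟨xᵢ⟩]`, so the image of `f (x i)`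
  -- there is `γ`-invariant and freeness applies.
  have hx : ∀ i, (orderOf γ : ℤ) ∣ augmentation _ (f (x i)) := by
    intro i
    obtain ⟨r, hr⟩ := foxDer_conePath_apply_x (ν := ν) u i
    obtain ⟨s, hs⟩ := foxDer_conePath_apply_x (ν := ν) (fuchsianLongWord g k) i
    refine orderOf_dvd_augmentation hγ (hfree i) (r := r - z' * s) ?_
    have h := DFunLike.congr_fun hf (x i)
    rw [Finsupp.smul_apply, smul_eq_mul] at h
    rw [← hτ, ← h, Finsupp.sub_apply, Finsupp.smul_apply, smul_eq_mul, sub_mul, mul_assoc, ← hr,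
      ← hs]
    rfl
  have hBf : (orderOf γ : ℤ) ∣ augmentation _ (baseBoundary g ν f) := by
    rw [baseBoundary, Finsupp.linearCombination_apply, Finsupp.sum, map_sum]
    refine Finset.dvd_sum fun e _ => ?_
    rw [smul_eq_mul, map_mul]
    cases e with
    | a j => simp only [map_sub, augmentation_of, map_one, sub_self, mul_zero, dvd_zero]
    | b j => simp only [map_sub, augmentation_of, map_one, sub_self, mul_zero, dvd_zero]
    | x i => exact Dvd.dvd.mul_right (hx i) _
  -- Augmenting `1 - ∂f = normElement γ * y`, where `∂` is `baseBoundary`, gives `1` modulo `orderOf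
  -- γ` on the left and `0` on the right.
  have h3 := congrArg (augmentation _) hy
  rw [map_sub, map_one, map_mul, augmentation_normElement] at h3
  have h4 : (orderOf γ : ℤ) ∣ 1 := by
    rw [← sub_add_cancel 1 (augmentation _ (baseBoundary g ν f)), h3]
    exact dvd_add (dvd_mul_right _ _) hBf
  exact Nat.dvd_one.1 (by exact_mod_cast h4)

end Torsion

/-! ### Infiniteness of Fuchsian groups and their finite-index subgroups. -/

section Elementary

instance finite_center_sl2 : Finite (Subgroup.center SL(2, ℝ)) :=
  have : NeZero (max (Fintype.card (Fin 2)) 1) := ⟨by simp⟩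
  Finite.of_equiv _ (Matrix.SpecialLinearGroup.center_equiv_rootsOfUnity (n := Fin 2)
    (R := ℝ)).symm.toEquiv

/-- A non-elementary subgroup of `PSL(2, ℝ)` is infinite. -/
theorem infinite_of_not_isElementaryPSL {Γ : Subgroup PSL(2, ℝ)} (h : ¬ IsElementaryPSL Γ) :
    Infinite Γ := by
  by_contra hinf
  rw [not_infinite_iff_finite] at hinf
  apply h
  left
  have hfin : Finite (pslLift Γ) := by
    have h1 : ((QuotientGroup.mk' (Subgroup.center SL(2, ℝ))) ⁻¹' (Γ : Set PSL(2, ℝ))).Finite := by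
      refine Set.Finite.preimage' (Set.toFinite _) fun b _ => ?_
      obtain ⟨c, rfl⟩ := QuotientGroup.mk'_surjective _ b
      refine (Set.finite_range fun z : Subgroup.center SL(2, ℝ) => c * z).subset ?_
      intro d hd
      have hd : QuotientGroup.mk' (Subgroup.center SL(2, ℝ)) d = QuotientGroup.mk' _ c := hd
      exact ⟨⟨c⁻¹ * d, QuotientGroup.eq.1 hd.symm⟩, by simp⟩
    exact h1.to_subtype
  exact ⟨UpperHalfPlane.I, Set.finite_range _⟩

/-- The `L`-orbit is covered by the translates of the `K`-orbit by finitely many coset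
representatives. -/
theorem finite_orbit_of_finiteIndex {L X : Type*} [Group L] [MulAction L X] (K : Subgroup L)
    [K.FiniteIndex] {z : X} (h : (MulAction.orbit K z).Finite) : (MulAction.orbit L z).Finite := by
  have h1 : (⋃ q : L ⧸ K, (fun y => q.out • y) '' MulAction.orbit K z).Finite :=
    Set.finite_iUnion fun q => h.image _
  refine h1.subset ?_
  rintro _ ⟨l, rfl⟩
  refine Set.mem_iUnion.2 ⟨(l : L ⧸ K), ?_⟩
  obtain ⟨c, hc⟩ := QuotientGroup.mk_out_eq_mul K l
  refine ⟨(c⁻¹ : K) • z, ⟨c⁻¹, rfl⟩, ?_⟩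
  simp only
  rw [hc, Subgroup.smul_def, smul_smul]
  simp

theorem finite_orbit_of_relIndex_ne_zero {L X : Type*} [Group L] [MulAction L X]
    {H K : Subgroup L} (hind : H.relIndex K ≠ 0) {z : X}
    (h : (MulAction.orbit H z).Finite) : (MulAction.orbit K z).Finite := by
  have : (H.subgroupOf K).FiniteIndex := ⟨hind⟩
  refine finite_orbit_of_finiteIndex (H.subgroupOf K) (h.subset ?_)
  rintro _ ⟨⟨c, hc⟩, rfl⟩
  exact ⟨⟨c, hc⟩, rfl⟩

theorem isElementaryPSL_of_relIndex_ne_zero {Γ Δ : Subgroup PSL(2, ℝ)}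
    (hind : Γ.relIndex Δ ≠ 0) (h : IsElementaryPSL Γ) : IsElementaryPSL Δ := by
  have hind' : (pslLift Γ).relIndex (pslLift Δ) ≠ 0 := by
    rw [pslLift, pslLift, Subgroup.relIndex_comap,
      Subgroup.map_comap_eq_self_of_surjective (QuotientGroup.mk'_surjective _)]
    exact hind
  rcases h with ⟨z, hz⟩ | ⟨z, hz⟩
  · exact Or.inl ⟨z, finite_orbit_of_relIndex_ne_zero hind' hz⟩
  · exact Or.inr ⟨z, finite_orbit_of_relIndex_ne_zero hind' hz⟩

/-- A finite index subgroup of a Fuchsian group is Fuchsian. -/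
theorem IsFuchsian.map_subtype {Γ : Subgroup PSL(2, ℝ)} (hΓ : IsFuchsian Γ) (K : Subgroup Γ)
    [K.FiniteIndex] : IsFuchsian (K.map Γ.subtype) where
  fg := by
    have : Group.FG Γ := (Group.fg_iff_subgroup_fg Γ).2 hΓ.fg
    have hK : K.FG := (Group.fg_iff_subgroup_fg K).1 (Subgroup.fg_of_index_ne_zero K)
    rw [Subgroup.fg_iff_submonoid_fg] at hK ⊢
    exact hK.map Γ.subtype
  discrete := by
    have := hΓ.discrete
    exact DiscreteTopology.of_subset (s := (Γ : Set PSL(2, ℝ))) this (Subgroup.map_subtype_le K)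
  nonelementary h := by
    refine hΓ.nonelementary (isElementaryPSL_of_relIndex_ne_zero ?_ h)
    rw [Subgroup.relIndex, Subgroup.subgroupOf,
      Subgroup.comap_map_eq_self_of_injective Γ.subtype_injective]
    exact Subgroup.FiniteIndex.index_ne_zero

end Elementary

/-! ### Torsion-freeness of kernels. -/

section SurfaceKernel

open FuchsianGen

variable {g k : ℕ} {ν : Fin k → ℕ}

theorem of_x_pow (i : Fin k) :
    (PresentedGroup.of (x i) : PresentedGroup (fuchsianRels g ν)) ^ ν i = 1 :=
  (map_pow (PresentedGroup.mk (fuchsianRels g ν)) (FreeGroup.of (x i)) (ν i)).symm.trans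
    (of_pow_period i)

/-- A homomorphism preserving the orders of all the elliptic generators has torsion-free kernel. -/
theorem eq_one_of_mem_ker_of_isOfFinOrder [Infinite (PresentedGroup (fuchsianRels g ν))]
    {A : Type*} [Group A] (ψ : PresentedGroup (fuchsianRels g ν) →* A)
    (hψ : ∀ i, orderOf (ψ (PresentedGroup.of (x i))) = ν i)
    {γ : PresentedGroup (fuchsianRels g ν)} (hker : ψ γ = 1) (hfin : IsOfFinOrder γ) : γ = 1 := by
  rw [← orderOf_eq_one_iff]
  refine orderOf_eq_one_of_free hfin.orderOf_pos fun i u h hh hu => ?_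
  obtain ⟨n, rfl⟩ := hh
  obtain ⟨m, hm⟩ := hu
  simp only at hm
  -- Powers of `γ` lie in the kernel, and so do their conjugates. Hence `νᵢ ∣ m`, and the relator
  -- alone gives `xᵢ ^ m = 1`; the exact order of `xᵢ` is not needed.
  have h1 : ψ (PresentedGroup.of (x i)) ^ m = 1 := by
    rw [← map_zpow, hm]
    simp [hker]
  rw [← orderOf_dvd_iff_zpow_eq_one, hψ] at h1
  have h2 : (PresentedGroup.of (x i) : PresentedGroup (fuchsianRels g ν)) ^ m = 1 := by
    rw [← orderOf_dvd_iff_zpow_eq_one]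
    exact (Int.natCast_dvd_natCast.2 (orderOf_dvd_of_pow_eq_one (of_x_pow i))).trans h1
  rw [h2] at hm
  have h3 : γ ^ n = u * (u⁻¹ * γ ^ n * u) * u⁻¹ := by group
  simp only
  rw [h3, ← hm, mul_one, mul_inv_cancel]

end SurfaceKernel

/-! ### Orders of the elliptic generators and the criterion for surface kernels. -/

section OrderOfGenerators

open FuchsianGen

variable {g k : ℕ} {ν : Fin k → ℕ}

theorem lift_fuchsianLongWord {A : Type*} [CommGroup A] (f : FuchsianGen g k → A) :
    FreeGroup.lift f (fuchsianLongWord g k) = ∏ i, f (x i) := by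
  rw [fuchsianLongWord, map_mul, map_list_prod, map_list_prod, List.map_ofFn, List.map_ofFn,
    List.prod_ofFn, List.prod_ofFn]
  simp

theorem lift_eq_one_of_mem_fuchsianRels {A : Type*} [CommGroup A] {f : FuchsianGen g k → A}
    (h1 : ∀ i, f (x i) ^ ν i = 1) (h2 : ∏ i, f (x i) = 1) :
    ∀ r ∈ fuchsianRels g ν, FreeGroup.lift f r = 1 := by
  rintro r (⟨i, rfl⟩ | hr)
  · simpa using h1 i
  · rw [Set.mem_singleton_iff.1 hr, lift_fuchsianLongWord, h2]

theorem prod_of_x_eq_one {A : Type*} [CommGroup A] (φ : PresentedGroup (fuchsianRels g ν) →* A) :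
    ∏ i, φ (PresentedGroup.of (x i)) = 1 := by
  have h1 : FreeGroup.lift (fun e => φ (PresentedGroup.of e)) =
      φ.comp (PresentedGroup.mk (fuchsianRels g ν)) := by
    ext e
    simp only [FreeGroup.lift_apply_of]
    rfl
  rw [← lift_fuchsianLongWord (fun e => φ (PresentedGroup.of e)), h1, MonoidHom.comp_apply,
    PresentedGroup.one_of_mem (Or.inr rfl), map_one]

/-- With at least two equal periods, the elliptic generators have the full order. -/
theorem orderOf_of_x {N : ℕ} (heq : ∀ i, ν i = N) {i i' : Fin k} (hne : i' ≠ i) :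
    orderOf (PresentedGroup.of (x i) : PresentedGroup (fuchsianRels g ν)) = N := by
  apply Nat.dvd_antisymm
  · rw [← heq i]
    exact orderOf_dvd_of_pow_eq_one (of_x_pow i)
  -- Sending `xᵢ` to `1` and `xᵢ'` to `-1` respects the long relation and gives `xᵢ` an image of
  -- order `N`.
  · let f : FuchsianGen g k → Multiplicative (ZMod N) := fun e => match e with
      | a _ => 1
      | b _ => 1
      | x j => if j = i then Multiplicative.ofAdd 1 else
          if j = i' then Multiplicative.ofAdd (-1) else 1
    have h1 : ∀ j, f (x j) ^ ν j = 1 := by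
      intro j
      rw [heq, ← toAdd_eq_zero, toAdd_pow, nsmul_eq_mul, ZMod.natCast_self, zero_mul]
    have h2 : ∏ j, f (x j) = 1 := by
      rw [Fintype.prod_eq_mul i i' hne.symm]
      · simp [f, hne]
      · rintro j ⟨hj, hj'⟩
        simp [f, hj, hj']
    have h3 := orderOf_map_dvd
      (PresentedGroup.toGroup (lift_eq_one_of_mem_fuchsianRels h1 h2)) (PresentedGroup.of (x i))
    rw [PresentedGroup.toGroup.of] at h3
    have h4 : f (x i) = Multiplicative.ofAdd 1 := if_pos rfl
    rwa [h4, orderOf_ofAdd_eq_addOrderOf, ZMod.addOrderOf_one] at h3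

/-- With one period and positive genus, the elliptic generator is nontrivial, as is seen in a
dihedral group. -/
theorem of_x_ne_one {N : ℕ} (hN : 2 ≤ N) {ν : Fin 1 → ℕ} (heq : ∀ i, ν i = N) (j₀ : Fin g)
    (i : Fin 1) : (PresentedGroup.of (x i) : PresentedGroup (fuchsianRels g ν)) ≠ 1 := by
  -- A reflection and the rotation `r` of order `2N` have commutator `r²`, which `x₁ ↦ r⁻²` cancels
  -- in the long relation. As `r²` has order `N ≥ 2`, the image of `x₁` is nontrivial.
  let f : FuchsianGen g 1 → DihedralGroup (2 * N) := fun e => match e with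
    | a j => if j = j₀ then DihedralGroup.sr 0 else 1
    | b j => if j = j₀ then DihedralGroup.r 1 else 1
    | x _ => DihedralGroup.r (-2)
  have hf : ∀ r ∈ fuchsianRels g ν, FreeGroup.lift f r = 1 := by
    rintro r (⟨i, rfl⟩ | hr)
    · simp only [map_pow, FreeGroup.lift_apply_of, heq, f, DihedralGroup.r_pow]
      rw [DihedralGroup.one_def]
      congr 1
      have : (((2 * N : ℕ) : ZMod (2 * N))) = 0 := ZMod.natCast_self _
      push_cast at this
      rw [neg_mul, this, neg_zero]
    · rw [Set.mem_singleton_iff.1 hr, fuchsianLongWord, map_mul, map_list_prod, map_list_prod,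
        List.map_ofFn, List.map_ofFn]
      have h1 : ∀ j : Fin g, (FreeGroup.lift f) ((FreeGroup.of (a j))⁻¹ * (FreeGroup.of (b j))⁻¹ *
          FreeGroup.of (a j) * FreeGroup.of (b j)) = if j = j₀ then DihedralGroup.r 2 else 1 := by
        intro j
        simp only [map_mul, map_inv, FreeGroup.lift_apply_of, f]
        split_ifs
        · simp only [DihedralGroup.inv_sr, DihedralGroup.inv_r, DihedralGroup.sr_mul_r,
            DihedralGroup.sr_mul_sr, DihedralGroup.r_mul_r]
          congr 1
          ring
        · simp
      have h2 : ∀ n (j₀ : Fin n), (List.ofFn fun j : Fin n => if j = j₀ then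
          (DihedralGroup.r 2 : DihedralGroup (2 * N)) else 1).prod = DihedralGroup.r 2 := by
        intro n
        induction n with
        | zero => exact fun j => j.elim0
        | succ n ih =>
          intro j
          rw [List.ofFn_succ, List.prod_cons]
          refine Fin.cases ?_ (fun j => ?_) j
          · have : (fun i : Fin n => if i.succ = 0 then
                (DihedralGroup.r 2 : DihedralGroup (2 * N)) else 1) = fun _ => 1 := by
              funext i
              rw [if_neg (Fin.succ_ne_zero i)]
            rw [this]
            simp
          · rw [if_neg (Fin.succ_ne_zero j).symm, one_mul]
            simp only [Fin.succ_inj]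
            exact ih j
      simp only [Function.comp_def, h1, h2]
      simp [f]
  intro h
  have h1 := congrArg (PresentedGroup.toGroup hf) h
  rw [PresentedGroup.toGroup.of, map_one, DihedralGroup.one_def] at h1
  have h2 : (-2 : ZMod (2 * N)) = 0 := by injection h1
  have h3 : ((2 : ℕ) : ZMod (2 * N)) = 0 := by
    push_cast
    rw [← neg_eq_zero, h2]
  rw [ZMod.natCast_eq_zero_iff] at h3
  have := Nat.le_of_dvd (by norm_num) h3
  omega

/-- If the kernel is torsion-free, raising `xᵢ` to the order of its image gives a torsion element of
the kernel, hence `1`, so no order is lost. The converse is the torsion theorem. -/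
theorem isSurfaceKernelEpi_iff {Γ : Subgroup PSL(2, ℝ)} (hΓ : IsFuchsian Γ)
    (e : PresentedGroup (fuchsianRels g ν) ≃* Γ) {N : ℕ} (hν : ∀ i, 2 ≤ ν i) (heq : ∀ i, ν i = N)
    {A : Type*} [CommGroup A] [Finite A] (φ : Γ →* A) :
    IsSurfaceKernelEpi φ ↔ Function.Surjective φ ∧
      ∀ i, orderOf (φ (e (PresentedGroup.of (x i)))) = N := by
  have hinf : Infinite Γ := infinite_of_not_isElementaryPSL hΓ.nonelementary
  have hinf' : Infinite (PresentedGroup (fuchsianRels g ν)) := Infinite.of_injective _ e.symm.injective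
  constructor
  · intro h
    refine ⟨h.surjective, fun i => ?_⟩
    have htf : ∀ γ : PresentedGroup (fuchsianRels g ν), φ (e γ) = 1 → IsOfFinOrder γ → γ = 1 := by
      intro γ hγ hfin
      have h1 := h.ker_surface.torsionFree (e γ) ⟨e γ, hγ, rfl⟩
        ((Γ.subtype.comp e.toMonoidHom).isOfFinOrder hfin)
      exact e.injective (by rw [map_one]; exact Subtype.ext h1)
    have hfin : IsOfFinOrder (PresentedGroup.of (x i) : PresentedGroup (fuchsianRels g ν)) :=
      isOfFinOrder_iff_pow_eq_one.2 ⟨ν i, by have := hν i; omega, of_x_pow i⟩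
    by_cases hk : ∃ i', i' ≠ i
    · obtain ⟨i', hi'⟩ := hk
      apply Nat.dvd_antisymm
      · apply orderOf_dvd_of_pow_eq_one
        rw [← map_pow, ← map_pow, ← heq i, of_x_pow, map_one, map_one]
      · rw [← orderOf_of_x (g := g) heq hi']
        apply orderOf_dvd_of_pow_eq_one
        apply htf
        · rw [map_pow, map_pow, pow_orderOf_eq_one]
        · exact hfin.pow
    -- With one period the long relation forces `φ(x₁) = 1` in an abelian group, so torsion-freeness
    -- would give `x₁ = 1`. In genus zero the infinite group would then be trivial; in positive
    -- genus the dihedral quotient contradicts it.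
    · exfalso
      push Not at hk
      obtain rfl : k = 1 := by
        have h1 : Fintype.card (Fin k) = 1 := Fintype.card_eq_one_iff.2 ⟨i, hk⟩
        simpa using h1
      have h1 : φ (e (PresentedGroup.of (x i))) = 1 := by
        have := prod_of_x_eq_one (φ.comp e.toMonoidHom)
        rw [Fintype.prod_eq_single i fun j hj => absurd (hk j) hj] at this
        exact this
      have h2 := htf _ h1 hfin
      rcases Nat.eq_zero_or_pos g with rfl | hg
      · have h3 : (⊤ : Subgroup (PresentedGroup (fuchsianRels 0 ν))) = ⊥ := by
          rw [← PresentedGroup.closure_range_of, Subgroup.closure_eq_bot_iff]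
          rintro _ ⟨y, rfl⟩
          cases y with
          | a j => exact j.elim0
          | b j => exact j.elim0
          | x j => rw [hk j]; exact h2
        have h4 := Subgroup.subsingleton_iff.1 (subsingleton_of_bot_eq_top h3.symm)
        exact not_finite (PresentedGroup (fuchsianRels 0 ν))
      · exact of_x_ne_one (heq i ▸ hν i) heq ⟨0, hg⟩ i h2
  · rintro ⟨hsurj, hord⟩
    have hfi : φ.ker.FiniteIndex := inferInstance
    refine ⟨hsurj, hΓ.map_subtype φ.ker, ?_⟩
    rintro _ ⟨γ, hγ, rfl⟩ hfin
    have h1 : e.symm γ = 1 := by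
      refine eq_one_of_mem_ker_of_isOfFinOrder (φ.comp e.toMonoidHom)
        (fun i => (hord i).trans (heq i).symm) ?_ ?_
      · simpa using hγ
      · exact e.symm.toMonoidHom.isOfFinOrder
          (Γ.subtype_injective.isOfFinOrder_iff.1 hfin)
    have h2 : γ = 1 := by simpa using h1
    rw [h2, map_one]

end OrderOfGenerators

/-! ### Counting tuples of residues by the Chinese remainder theorem. -/

section Counting

/-- All fibres of a surjective homomorphism are cosets of its kernel, so preimages scale
cardinalities by `|A| / |B|`. -/
theorem card_preimage_mul_card {A B : Type*} [AddGroup A] [AddGroup B] [Finite A] {f : A →+ B}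
    (hf : Function.Surjective f) (T : Set B) :
    Nat.card (f ⁻¹' T) * Nat.card B = Nat.card T * Nat.card A := by
  have key : ∀ T : Set B, Nat.card (f ⁻¹' T) = Nat.card T * Nat.card f.ker := by
    intro T
    rw [← Nat.card_prod]
    choose s hs using hf
    refine Nat.card_congr
      { toFun := fun a => (⟨f a, a.2⟩, ⟨a - s (f a), by
          rw [AddMonoidHom.mem_ker, map_sub, hs, sub_self]⟩)
        invFun := fun b => ⟨b.2 + s b.1, ?_⟩
        left_inv := ?_
        right_inv := ?_ }
    · change f (b.2 + s b.1) ∈ T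
      rw [map_add, hs, (AddMonoidHom.mem_ker.1 b.2.2 : f b.2 = 0), zero_add]
      exact b.1.2
    · intro a
      simp
    · rintro ⟨⟨b, hb⟩, ⟨c, hc⟩⟩
      have hc' : f c = 0 := hc
      ext <;> simp [hs, hc']
  have h := key Set.univ
  rw [Set.preimage_univ, Nat.card_congr (Equiv.Set.univ A), Nat.card_congr (Equiv.Set.univ B)] at h
  rw [key T, h]
  ring

/-- The Chinese remainder theorem for a set of prime divisors of `n`. -/
theorem exists_cast_eq {n : ℕ} {S : Finset ℕ} (hS : S ⊆ n.primeFactors)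
    (y : ∀ p : S, ZMod p) : ∃ c : ZMod n, ∀ p : S, (c.cast : ZMod p) = y p := by
  have hcop : Pairwise (Function.onFun Nat.Coprime fun p : S => (p : ℕ)) := by
    intro p q hpq
    exact (Nat.coprime_primes (Nat.prime_of_mem_primeFactors (hS p.2))
      (Nat.prime_of_mem_primeFactors (hS q.2))).2 fun h => hpq (Subtype.ext h)
  have hdvd : ∏ p : S, (p : ℕ) ∣ n := by
    rw [Finset.prod_coe_sort S fun p => p]
    exact (Finset.prod_dvd_prod_of_subset _ _ _ hS).trans (Nat.prod_primeFactors_dvd n)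
  obtain ⟨c, hc⟩ := ZMod.castHom_surjective hdvd ((ZMod.prodEquivPi _ hcop).symm y)
  refine ⟨c, fun p => ?_⟩
  have hp : (p : ℕ) ∣ n := Nat.dvd_of_mem_primeFactors (hS p.2)
  have h1 : ((Pi.evalRingHom _ p).comp ((ZMod.prodEquivPi _ hcop).toRingHom.comp
      (ZMod.castHom hdvd _))) = ZMod.castHom hp (ZMod p) := Subsingleton.elim _ _
  have h2 := RingHom.congr_fun h1 c
  rw [ZMod.castHom_apply] at h2
  rw [← h2]
  change (ZMod.prodEquivPi _ hcop) (ZMod.castHom hdvd _ c) p = y p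
  rw [hc, RingEquiv.apply_symm_apply]

/-- Conditions at distinct prime divisors of `n` on a tuple of residues are independent. -/
theorem card_forall_prime_mul {κ : Type*} [Fintype κ] {n : ℕ} (hn : n ≠ 0) {S : Finset ℕ}
    (hS : S ⊆ n.primeFactors) (Q : ∀ p : ℕ, Set (κ → ZMod p)) :
    Nat.card {s : κ → ZMod n | ∀ p ∈ S, (fun i => ((s i).cast : ZMod p)) ∈ Q p} *
        ∏ p ∈ S, p ^ Fintype.card κ =
      (∏ p ∈ S, Nat.card (Q p)) * n ^ Fintype.card κ := by
  have : NeZero n := ⟨hn⟩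
  let f : (κ → ZMod n) →+ (∀ p : S, κ → ZMod p) :=
    { toFun := fun s p i => (s i).cast
      map_zero' := by
        funext p i
        exact ZMod.cast_zero
      map_add' := fun s t => by
        funext p i
        exact ZMod.cast_add (Nat.dvd_of_mem_primeFactors (hS p.2)) _ _ }
  have hf : Function.Surjective f := by
    intro y
    choose c hc using fun i => exists_cast_eq hS fun p => y p i
    refine ⟨c, ?_⟩
    funext p i
    exact hc i p
  have h := card_preimage_mul_card hf (Set.univ.pi fun p : S => Q p)
  have h1 : f ⁻¹' (Set.univ.pi fun p : S => Q p) =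
      {s : κ → ZMod n | ∀ p ∈ S, (fun i => ((s i).cast : ZMod p)) ∈ Q p} := by
    ext s
    constructor
    · intro hs p hp
      exact hs ⟨p, hp⟩ trivial
    · intro hs p _
      exact hs p p.2
  have h2 : Nat.card (Set.univ.pi fun p : S => Q p) = ∏ p ∈ S, Nat.card (Q p) := by
    rw [Nat.card_congr (Equiv.Set.univPi fun p : S => Q p), Nat.card_pi,
      Finset.prod_coe_sort S fun p => Nat.card (Q p)]
  have h3 : Nat.card (∀ p : S, κ → ZMod p) = ∏ p ∈ S, p ^ Fintype.card κ := by
    rw [Nat.card_pi, ← Finset.prod_coe_sort S fun p => p ^ Fintype.card κ]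
    refine Finset.prod_congr rfl fun p _ => ?_
    rw [Nat.card_fun, Nat.card_zmod, Nat.card_eq_fintype_card (α := κ)]
  rw [h1, h2, h3, Nat.card_fun, Nat.card_zmod, Nat.card_eq_fintype_card (α := κ)] at h
  exact h

/-- The number of tuples of residues modulo `n` that do not vanish modulo any prime divisor of
`M`, where `M ∣ n`. -/
theorem card_forall_prime_ne_zero {κ : Type*} [Fintype κ] {n M : ℕ} (hn : n ≠ 0) (hM : M ∣ n) :
    (Nat.card {s : κ → ZMod n | ∀ p ∈ M.primeFactors, ∃ i, ((s i).cast : ZMod p) ≠ 0} : ℚ) =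
      (n : ℚ) ^ Fintype.card κ *
        ∏ p ∈ M.primeFactors, (1 - 1 / (p : ℚ) ^ Fintype.card κ) := by
  have h := card_forall_prime_mul (κ := κ) hn (Nat.primeFactors_mono hM hn) fun p => {0}ᶜ
  have h1 : {s : κ → ZMod n | ∀ p ∈ M.primeFactors,
      (fun i => ((s i).cast : ZMod p)) ∈ ({0}ᶜ : Set (κ → ZMod p))} =
      {s : κ → ZMod n | ∀ p ∈ M.primeFactors, ∃ i, ((s i).cast : ZMod p) ≠ 0} := by
    ext s
    exact forall₂_congr fun p _ => Function.ne_iff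
  rw [h1] at h
  have h2 : ∀ p ∈ M.primeFactors, ((Nat.card ({0}ᶜ : Set (κ → ZMod p)) : ℕ) : ℚ) =
      (1 - 1 / (p : ℚ) ^ Fintype.card κ) * (p : ℚ) ^ Fintype.card κ := by
    intro p hp
    have hp0 := (Nat.prime_of_mem_primeFactors hp).ne_zero
    have : NeZero p := ⟨hp0⟩
    rw [Nat.card_coe_set_eq, Set.ncard_compl, Set.ncard_singleton, Nat.card_fun, Nat.card_zmod,
      Nat.card_eq_fintype_card (α := κ), Nat.cast_sub (Nat.one_le_pow _ _ (Nat.pos_of_ne_zero hp0))]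
    have : (p : ℚ) ≠ 0 := by exact_mod_cast hp0
    field_simp
    push_cast
    ring
  have h3 := congrArg (Nat.cast : ℕ → ℚ) h
  push_cast at h3
  rw [Finset.prod_congr rfl h2, Finset.prod_mul_distrib] at h3
  have h4 : (∏ p ∈ M.primeFactors, (p : ℚ) ^ Fintype.card κ) ≠ 0 := by
    refine Finset.prod_ne_zero_iff.2 fun p hp => pow_ne_zero _ ?_
    exact_mod_cast (Nat.prime_of_mem_primeFactors hp).ne_zero
  apply mul_right_cancel₀ h4
  rw [h3]
  ring

end Counting

/-! ### Tuples of units with sum zero. -/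

section CountingUnits

theorem ZMod.isUnit_iff_forall_cast_ne_zero {N : ℕ} (hN : N ≠ 0) (t : ZMod N) :
    IsUnit t ↔ ∀ p ∈ N.primeFactors, (t.cast : ZMod p) ≠ 0 := by
  have : NeZero N := ⟨hN⟩
  obtain ⟨m, rfl⟩ : ∃ m : ℕ, (m : ZMod N) = t := ⟨t.val, ZMod.natCast_zmod_val t⟩
  rw [ZMod.isUnit_iff_coprime]
  have h : ∀ p ∈ N.primeFactors, (((m : ZMod N).cast : ZMod p) ≠ 0 ↔ ¬ p ∣ m) := by
    intro p hp
    rw [ZMod.cast_natCast (Nat.dvd_of_mem_primeFactors hp), Ne, ZMod.natCast_eq_zero_iff]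
  constructor
  · intro hc p hp
    rw [h p hp]
    intro hpm
    exact Nat.not_coprime_of_dvd_of_dvd (Nat.prime_of_mem_primeFactors hp).one_lt hpm
      (Nat.dvd_of_mem_primeFactors hp) hc
  · intro hc
    refine Nat.coprime_of_dvd fun p hp hpm hpN => ?_
    have hp' : p ∈ N.primeFactors := Nat.mem_primeFactors.2 ⟨hp, hpN, hN⟩
    exact (h p hp').1 (hc p hp') hpm

/-- The number of `k`-tuples of nonzero residues modulo a prime with nonzero sum. -/
theorem card_ne_zero_sum_ne_zero (p : ℕ) (hp : p.Prime) (k : ℕ) :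
    (p : ℤ) * Nat.card {b : Fin k → ZMod p | (∀ i, b i ≠ 0) ∧ ∑ i, b i ≠ 0} =
      ((p : ℤ) - 1) ^ (k + 1) - (-1) ^ k * ((p : ℤ) - 1) := by
  classical
  have : Fact p.Prime := ⟨hp⟩
  have hall : ∀ k : ℕ, Nat.card {b : Fin k → ZMod p | ∀ i, b i ≠ 0} = (p - 1) ^ k := by
    intro k
    have h1 : {b : Fin k → ZMod p | ∀ i, b i ≠ 0} = Set.univ.pi fun _ => ({0}ᶜ : Set (ZMod p)) := by
      ext b
      simp
    rw [h1, Nat.card_congr (Equiv.Set.univPi fun _ : Fin k => ({0}ᶜ : Set (ZMod p))), Nat.card_pi,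
      Finset.prod_const, Nat.card_coe_set_eq, Set.ncard_compl, Set.ncard_singleton, Nat.card_zmod,
      Finset.card_univ, Fintype.card_fin]
  -- The first entry is minus the sum of the others, so its being nonzero is the condition on that
  -- sum.
  have hzero : ∀ k : ℕ, Nat.card {b : Fin (k + 1) → ZMod p | (∀ i, b i ≠ 0) ∧ ∑ i, b i = 0} =
      Nat.card {b : Fin k → ZMod p | (∀ i, b i ≠ 0) ∧ ∑ i, b i ≠ 0} := by
    intro k
    refine Nat.card_congr
      { toFun := fun b => ⟨fun i => b.1 i.succ, fun i => b.2.1 _, ?_⟩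
        invFun := fun b => ⟨Fin.cons (-∑ i, b.1 i) b.1, ?_, ?_⟩
        left_inv := ?_
        right_inv := ?_ }
    · have h := b.2.2
      rw [Fin.sum_univ_succ] at h
      intro h0
      rw [h0, add_zero] at h
      exact b.2.1 0 h
    · intro i
      refine Fin.cases ?_ (fun i => ?_) i
      · rw [Fin.cons_zero]
        exact neg_ne_zero.2 b.2.2
      · rw [Fin.cons_succ]
        exact b.2.1 i
    · rw [Fin.sum_univ_succ]
      simp
    · rintro ⟨b, hb, hb0⟩
      rw [Fin.sum_univ_succ] at hb0
      ext i
      refine Fin.cases ?_ (fun i => ?_) i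
      · simp only [Fin.cons_zero]
        rw [eq_comm]
        exact eq_neg_of_add_eq_zero_left hb0
      · simp only [Fin.cons_succ]
    · rintro ⟨b, hb⟩
      ext i
      simp
  have hsplit : ∀ k : ℕ, Nat.card {b : Fin k → ZMod p | (∀ i, b i ≠ 0) ∧ ∑ i, b i = 0} +
      Nat.card {b : Fin k → ZMod p | (∀ i, b i ≠ 0) ∧ ∑ i, b i ≠ 0} = (p - 1) ^ k := by
    intro k
    rw [← hall k, Nat.card_coe_set_eq, Nat.card_coe_set_eq, Nat.card_coe_set_eq,
      ← Set.ncard_union_eq]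
    · congr 1
      ext b
      constructor
      · rintro (h | h)
        · exact h.1
        · exact h.1
      · intro h
        by_cases h0 : ∑ i, b i = 0
        · exact Or.inl ⟨h, h0⟩
        · exact Or.inr ⟨h, h0⟩
    · rw [Set.disjoint_left]
      rintro b h h'
      exact h'.2 h.2
  have hp1 : ((p - 1 : ℕ) : ℤ) = (p : ℤ) - 1 := by
    rw [Nat.cast_sub hp.one_le, Nat.cast_one]
  -- If `B k` is the number sought, `hzero` and `hsplit` give `B (k + 1) = (p - 1) ^ (k + 1) - B k`.
  induction k with
  | zero =>
    have h1 : {b : Fin 0 → ZMod p | (∀ i, b i ≠ 0) ∧ ∑ i, b i ≠ 0} = ∅ := by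
      ext b
      simp
    rw [h1, Nat.card_coe_set_eq, Set.ncard_empty]
    push_cast
    ring
  | succ k ih =>
    have h1 := hsplit (k + 1)
    rw [hzero k] at h1
    have h2 := congrArg (Nat.cast : ℕ → ℤ) h1
    rw [Nat.cast_add, Nat.cast_pow, hp1] at h2
    rw [eq_sub_of_add_eq' h2, mul_sub, ih]
    ring

/-- The number of `k`-tuples of units modulo `N` with sum zero. -/
theorem card_units_sum_eq_zero {N : ℕ} (hN : N ≠ 0) (k : ℕ) :
    (Nat.card {t : Fin (k + 1) → ZMod N | (∀ i, IsUnit (t i)) ∧ ∑ i, t i = 0} : ℚ) =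
      (Nat.totient N : ℚ) ^ (k + 1) / N *
        ∏ p ∈ N.primeFactors, (1 - (-1) ^ k / ((p : ℚ) - 1) ^ k) := by
  have h0 : Nat.card {t : Fin (k + 1) → ZMod N | (∀ i, IsUnit (t i)) ∧ ∑ i, t i = 0} =
      Nat.card {s : Fin k → ZMod N | ∀ p ∈ N.primeFactors, (fun i => ((s i).cast : ZMod p)) ∈
        {b : Fin k → ZMod p | (∀ i, b i ≠ 0) ∧ ∑ i, b i ≠ 0}} := by
    have hset : {s : Fin k → ZMod N | ∀ p ∈ N.primeFactors, (fun i => ((s i).cast : ZMod p)) ∈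
        {b : Fin k → ZMod p | (∀ i, b i ≠ 0) ∧ ∑ i, b i ≠ 0}} =
        {s : Fin k → ZMod N | (∀ i, IsUnit (s i)) ∧ IsUnit (∑ i, s i)} := by
      ext s
      have hsum : ∀ p ∈ N.primeFactors, ((∑ i, s i : ZMod N).cast : ZMod p) =
          ∑ i, ((s i).cast : ZMod p) := fun p hp =>
        map_sum (ZMod.castHom (Nat.dvd_of_mem_primeFactors hp) (ZMod p)) s Finset.univ
      constructor
      · intro h
        refine ⟨fun i => ?_, ?_⟩
        · rw [ZMod.isUnit_iff_forall_cast_ne_zero hN]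
          exact fun p hp => (h p hp).1 i
        · rw [ZMod.isUnit_iff_forall_cast_ne_zero hN]
          intro p hp
          rw [hsum p hp]
          exact (h p hp).2
      · rintro ⟨h1, h2⟩ p hp
        refine ⟨fun i => ?_, ?_⟩
        · exact (ZMod.isUnit_iff_forall_cast_ne_zero hN _).1 (h1 i) p hp
        · rw [← hsum p hp]
          exact (ZMod.isUnit_iff_forall_cast_ne_zero hN _).1 h2 p hp
    rw [hset]
    refine Nat.card_congr
      { toFun := fun b => ⟨fun i => b.1 i.succ, fun i => b.2.1 _, ?_⟩
        invFun := fun b => ⟨Fin.cons (-∑ i, b.1 i) b.1, ?_, ?_⟩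
        left_inv := ?_
        right_inv := ?_ }
    · have h := b.2.2
      rw [Fin.sum_univ_succ] at h
      rw [← neg_eq_of_add_eq_zero_right h]
      exact (b.2.1 0).neg
    · intro i
      refine Fin.cases ?_ (fun i => ?_) i
      · rw [Fin.cons_zero]
        exact b.2.2.neg
      · rw [Fin.cons_succ]
        exact b.2.1 i
    · rw [Fin.sum_univ_succ]
      simp
    · rintro ⟨b, hb, hb0⟩
      rw [Fin.sum_univ_succ] at hb0
      ext i
      refine Fin.cases ?_ (fun i => ?_) i
      · simp only [Fin.cons_zero]
        rw [eq_comm]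
        exact eq_neg_of_add_eq_zero_left hb0
      · simp only [Fin.cons_succ]
    · rintro ⟨b, hb⟩
      ext i
      simp
  have h := card_forall_prime_mul (κ := Fin k) hN (Finset.Subset.refl N.primeFactors)
    fun p => {b : Fin k → ZMod p | (∀ i, b i ≠ 0) ∧ ∑ i, b i ≠ 0}
  rw [← h0, Fintype.card_fin] at h
  have h1 := congrArg (Nat.cast : ℕ → ℚ) h
  push_cast at h1
  have hN' : (N : ℚ) ≠ 0 := by exact_mod_cast hN
  -- The local count is arranged so that the factors `(1 - p⁻¹) ^ (k + 1)` multiply to `(φ(N) / N) ^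
  -- (k + 1)`.
  have h2 : ∀ p ∈ N.primeFactors,
      (Nat.card {b : Fin k → ZMod p | (∀ i, b i ≠ 0) ∧ ∑ i, b i ≠ 0} : ℚ) =
        (1 - (p : ℚ)⁻¹) ^ (k + 1) * (1 - (-1) ^ k / ((p : ℚ) - 1) ^ k) * (p : ℚ) ^ k := by
    intro p hp
    have hp' := Nat.prime_of_mem_primeFactors hp
    have hp0 : (p : ℚ) ≠ 0 := by exact_mod_cast hp'.ne_zero
    have hp1 : (p : ℚ) - 1 ≠ 0 := by
      rw [sub_ne_zero]
      exact_mod_cast hp'.one_lt.ne'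
    have h3 := congrArg (Int.cast : ℤ → ℚ) (card_ne_zero_sum_ne_zero p hp' k)
    push_cast at h3
    apply mul_left_cancel₀ hp0
    rw [h3]
    have h4 : 1 - (p : ℚ)⁻¹ = ((p : ℚ) - 1) / p := by
      field_simp
    rw [h4, div_pow]
    field_simp
    ring
  rw [Finset.prod_congr rfl h2, Finset.prod_mul_distrib, Finset.prod_mul_distrib,
    Finset.prod_pow _ (k + 1)] at h1
  have h4 : (∏ p ∈ N.primeFactors, (p : ℚ) ^ k) ≠ 0 := by
    refine Finset.prod_ne_zero_iff.2 fun p hp => pow_ne_zero _ ?_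
    exact_mod_cast (Nat.prime_of_mem_primeFactors hp).ne_zero
  apply mul_right_cancel₀ h4
  rw [h1, Nat.totient_eq_mul_prod_factors]
  field_simp
  ring

end CountingUnits

/-! ### Generating sets and elements of given order in a cyclic group. -/

section Generation

/-- A subgroup of `ℤ/n` is everything iff it is nontrivial modulo every prime divisor of `n`. -/
theorem ZMod.addSubgroup_eq_top_iff {n : ℕ} (hn : n ≠ 0) (H : AddSubgroup (ZMod n)) :
    H = ⊤ ↔ ∀ p ∈ n.primeFactors, ∃ h ∈ H, (h.cast : ZMod p) ≠ 0 := by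
  have : NeZero n := ⟨hn⟩
  constructor
  · rintro rfl p hp
    have : Fact p.Prime := ⟨Nat.prime_of_mem_primeFactors hp⟩
    exact ⟨1, trivial, by rw [ZMod.cast_one (Nat.dvd_of_mem_primeFactors hp)]; exact one_ne_zero⟩
  · intro h
    by_contra hH
    have hidx : H.index ≠ 1 := fun h1 => hH (AddSubgroup.index_eq_one.1 h1)
    -- For a prime `p` dividing the index, `H` consists of multiples of `p`: the order of `H` kills
    -- `c`, so `n = |H| · index` divides `|H| · c` and the index divides `c`.
    obtain ⟨p, hp, hpd⟩ := Nat.exists_prime_and_dvd hidx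
    have hcard : Nat.card H * H.index = n := by
      rw [AddSubgroup.card_mul_index, Nat.card_zmod]
    have hpn : p ∣ n := hcard ▸ hpd.mul_left _
    obtain ⟨c, hc, hcp⟩ := h p (Nat.mem_primeFactors.2 ⟨hp, hpn, hn⟩)
    apply hcp
    rw [ZMod.cast_eq_val, ZMod.natCast_eq_zero_iff]
    have h1 : Nat.card H • (⟨c, hc⟩ : H) = 0 := card_nsmul_eq_zero'
    have h2 : ((Nat.card H * c.val : ℕ) : ZMod n) = 0 := by
      have := congrArg Subtype.val h1
      rw [Nat.cast_mul, ZMod.natCast_zmod_val, ← nsmul_eq_mul]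
      exact this
    rw [ZMod.natCast_eq_zero_iff] at h2
    have h3 : Nat.card H * H.index ∣ Nat.card H * c.val := by rwa [hcard]
    exact hpd.trans (Nat.dvd_of_mul_dvd_mul_left Nat.card_pos h3)

/-- Reduction modulo `p` is a homomorphism, so it vanishes on the closure as soon as it vanishes on
the generators. -/
theorem ZMod.closure_range_eq_top_iff {n : ℕ} (hn : n ≠ 0) {κ : Type*} (v : κ → ZMod n) :
    AddSubgroup.closure (Set.range v) = ⊤ ↔
      ∀ p ∈ n.primeFactors, ∃ i, ((v i).cast : ZMod p) ≠ 0 := by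
  rw [ZMod.addSubgroup_eq_top_iff hn]
  refine forall₂_congr fun p hp => ⟨fun h => ?_, ?_⟩
  · by_contra! hv
    obtain ⟨c, hc, hcp⟩ := h
    apply hcp
    have h1 : AddSubgroup.closure (Set.range v) ≤
        (ZMod.castHom (Nat.dvd_of_mem_primeFactors hp) (ZMod p)).toAddMonoidHom.ker := by
      rw [AddSubgroup.closure_le]
      rintro _ ⟨i, rfl⟩
      exact hv i
    exact h1 hc
  · rintro ⟨i, hi⟩
    exact ⟨v i, AddSubgroup.subset_closure ⟨i, rfl⟩, hi⟩

variable {N M : ℕ}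

/-- The embedding of `ℤ/N` into `ℤ/NM` by multiplication by `M`. -/
noncomputable def ZMod.mulEmbedding (N M : ℕ) : ZMod N →+ ZMod (N * M) :=
  ZMod.lift N ⟨(AddMonoidHom.mulLeft (M : ZMod (N * M))).comp (Int.castAddHom _), by
    change (M : ZMod (N * M)) * ((N : ℤ) : ZMod (N * M)) = 0
    rw [Int.cast_natCast, ← Nat.cast_mul, mul_comm, ZMod.natCast_self]⟩

theorem ZMod.mulEmbedding_natCast (m : ℕ) :
    ZMod.mulEmbedding N M (m : ZMod N) = ((M * m : ℕ) : ZMod (N * M)) := by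
  rw [← Int.cast_natCast (R := ZMod N), ZMod.mulEmbedding, ZMod.lift_coe]
  change (M : ZMod (N * M)) * ((m : ℤ) : ZMod (N * M)) = _
  rw [Int.cast_natCast, Nat.cast_mul]

theorem ZMod.mulEmbedding_injective (hN : N ≠ 0) (hM : M ≠ 0) :
    Function.Injective (ZMod.mulEmbedding N M) := by
  have : NeZero N := ⟨hN⟩
  rw [injective_iff_map_eq_zero]
  intro t ht
  rw [← ZMod.natCast_zmod_val t, ZMod.mulEmbedding_natCast, ZMod.natCast_eq_zero_iff,
    mul_comm] at ht
  rw [← ZMod.natCast_zmod_val t, ZMod.natCast_eq_zero_iff]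
  rw [mul_comm] at ht
  rw [mul_comm N M] at ht
  exact Nat.dvd_of_mul_dvd_mul_left (Nat.pos_of_ne_zero hM) ht

theorem ZMod.addOrderOf_eq_iff_isUnit (hN : N ≠ 0) (t : ZMod N) : addOrderOf t = N ↔ IsUnit t := by
  have : NeZero N := ⟨hN⟩
  obtain ⟨m, rfl⟩ : ∃ m : ℕ, (m : ZMod N) = t := ⟨t.val, ZMod.natCast_zmod_val t⟩
  rw [ZMod.addOrderOf_coe _ hN, ZMod.isUnit_iff_coprime, Nat.coprime_comm, Nat.Coprime,
    Nat.div_eq_self]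
  simp [hN]

theorem ZMod.mem_range_mulEmbedding (hN : N ≠ 0) (hM : M ≠ 0) {c : ZMod (N * M)}
    (hc : N • c = 0) : ∃ t, ZMod.mulEmbedding N M t = c := by
  have : NeZero (N * M) := ⟨mul_ne_zero hN hM⟩
  rw [← ZMod.natCast_zmod_val c, nsmul_eq_mul, ← Nat.cast_mul, ZMod.natCast_eq_zero_iff] at hc
  obtain ⟨m, hm⟩ := Nat.dvd_of_mul_dvd_mul_left (Nat.pos_of_ne_zero hN) hc
  refine ⟨(m : ZMod N), ?_⟩
  rw [ZMod.mulEmbedding_natCast, ← hm, ZMod.natCast_zmod_val]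

end Generation

/-! ### Epimorphisms as generating vectors. -/

section Epimorphisms

open FuchsianGen

variable {g k : ℕ} {ν : Fin k → ℕ}

/-- The images of the generators under a surface-kernel epimorphism to `ℤ/n`. -/
def generatingVectors (g k N n : ℕ) : Set (FuchsianGen g k → ZMod n) :=
  {v | AddSubgroup.closure (Set.range v) = ⊤ ∧ (∀ i, addOrderOf (v (x i)) = N) ∧
    ∑ i, v (x i) = 0}

theorem surjective_iff_closure_range {Γ : Type*} [Group Γ]
    (e : PresentedGroup (fuchsianRels g ν) ≃* Γ) {n : ℕ} (φ : Γ →* Multiplicative (ZMod n)) :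
    Function.Surjective φ ↔ AddSubgroup.closure
      (Set.range fun y => (φ (e (PresentedGroup.of y))).toAdd) = ⊤ := by
  have h1 : (⊤ : Subgroup Γ) = Subgroup.closure (Set.range fun y => e (PresentedGroup.of y)) := by
    rw [← Subgroup.map_top_of_surjective e.toMonoidHom e.surjective,
      ← PresentedGroup.closure_range_of, MonoidHom.map_closure, ← Set.range_comp]
    rfl
  rw [← MonoidHom.range_eq_top, MonoidHom.range_eq_map, h1, MonoidHom.map_closure,
    ← Set.range_comp, ← Subgroup.toAddSubgroup'.injective.eq_iff, Subgroup.toAddSubgroup'_closure]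
  rfl

theorem nonempty_surfaceKernelEpis_equiv {Γ : Subgroup PSL(2, ℝ)} (hΓ : IsFuchsian Γ)
    (e : PresentedGroup (fuchsianRels g ν) ≃* Γ) {N : ℕ} (hν : ∀ i, 2 ≤ ν i) (heq : ∀ i, ν i = N)
    {n : ℕ} (hn : n ≠ 0) :
    Nonempty (surfaceKernelEpis Γ n ≃ generatingVectors g k N n) := by
  have : NeZero n := ⟨hn⟩
  let F : (Γ →* Multiplicative (ZMod n)) → (FuchsianGen g k → ZMod n) :=
    fun φ y => (φ (e (PresentedGroup.of y))).toAdd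
  have hF : Function.Injective F := by
    intro φ ψ h
    have h1 : φ.comp e.toMonoidHom = ψ.comp e.toMonoidHom := by
      refine PresentedGroup.ext fun y => ?_
      exact Multiplicative.toAdd.injective (congrFun h y)
    ext γ
    obtain ⟨δ, rfl⟩ := e.surjective γ
    exact congrArg Multiplicative.toAdd (DFunLike.congr_fun h1 δ)
  have himg : F '' surfaceKernelEpis Γ n = generatingVectors g k N n := by
    ext v
    constructor
    · rintro ⟨φ, hφ, rfl⟩
      obtain ⟨h1, h2⟩ := (isSurfaceKernelEpi_iff hΓ e hν heq φ).1 hφ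
      refine ⟨(surjective_iff_closure_range e φ).1 h1, fun i => ?_, ?_⟩
      · rw [← h2 i]
        rfl
      · have := prod_of_x_eq_one (φ.comp e.toMonoidHom)
        exact (toAdd_prod _ _).symm.trans (congrArg Multiplicative.toAdd this)
    · rintro ⟨h1, h2, h3⟩
      let f : FuchsianGen g k → Multiplicative (ZMod n) := fun y => Multiplicative.ofAdd (v y)
      have hf : ∀ r ∈ fuchsianRels g ν, FreeGroup.lift f r = 1 := by
        refine lift_eq_one_of_mem_fuchsianRels (fun i => ?_) ?_
        · rw [heq, ← h2 i]
          exact congrArg Multiplicative.ofAdd (addOrderOf_nsmul_eq_zero (v (x i)))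
        · rw [← ofAdd_sum, h3, ofAdd_zero]
      let φ : Γ →* Multiplicative (ZMod n) := (PresentedGroup.toGroup hf).comp e.symm.toMonoidHom
      have hφ : F φ = v := by
        funext y
        have : φ (e (PresentedGroup.of y)) = f y := by
          change PresentedGroup.toGroup hf (e.symm (e (PresentedGroup.of y))) = f y
          rw [e.symm_apply_apply, PresentedGroup.toGroup.of]
        exact congrArg Multiplicative.toAdd this
      refine ⟨φ, (isSurfaceKernelEpi_iff hΓ e hν heq φ).2 ⟨?_, fun i => ?_⟩, hφ⟩
      · rw [surjective_iff_closure_range e]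
        change AddSubgroup.closure (Set.range (F φ)) = ⊤
        rw [hφ, h1]
      · rw [← h2 i, ← hφ]
        rfl
  rw [← himg]
  exact ⟨Equiv.Set.image F _ hF⟩

end Epimorphisms

/-! ### Splitting generating vectors and the final formula. -/

section FinalCount

open FuchsianGen

variable {g k : ℕ}

/-- Assemble a vector of images of the generators. -/
noncomputable def assembleVector (N M : ℕ) (s : Fin g ⊕ Fin g → ZMod (N * M)) (t : Fin k → ZMod N) :
    FuchsianGen g k → ZMod (N * M)
  | a j => s (Sum.inl j)
  | b j => s (Sum.inr j)
  | x i => ZMod.mulEmbedding N M (t i)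

/-- The images `M tᵢ` of the `xᵢ` vanish modulo primes dividing `M`, so there `s` alone must be
nonzero. A prime dividing `N` but not `M` is handled by the unit `t₀`; when `k = 0` there is no such
prime because `N = 1`. -/
theorem closure_range_assembleVector {N M : ℕ} (hN : N ≠ 0) (hM : M ≠ 0) (hk : k = 0 → N = 1)
    (s : Fin g ⊕ Fin g → ZMod (N * M)) {t : Fin k → ZMod N} (ht : ∀ i, IsUnit (t i)) :
    AddSubgroup.closure (Set.range (assembleVector N M s t)) = ⊤ ↔
      ∀ p ∈ M.primeFactors, ∃ j, ((s j).cast : ZMod p) ≠ 0 := by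
  have : NeZero N := ⟨hN⟩
  have hcast : ∀ p ∈ (N * M).primeFactors, ∀ i,
      ((ZMod.mulEmbedding N M (t i)).cast : ZMod p) ≠ 0 ↔ ¬ p ∣ M * (t i).val := by
    intro p hp i
    conv_lhs => rw [← ZMod.natCast_zmod_val (t i)]
    rw [ZMod.mulEmbedding_natCast, ZMod.cast_natCast (Nat.dvd_of_mem_primeFactors hp), Ne,
      ZMod.natCast_eq_zero_iff]
  rw [ZMod.closure_range_eq_top_iff (mul_ne_zero hN hM)]
  constructor
  · intro h p hp
    have hp' : p ∈ (N * M).primeFactors :=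
      Nat.primeFactors_mono (dvd_mul_left M N) (mul_ne_zero hN hM) hp
    obtain ⟨y, hy⟩ := h p hp'
    cases y with
    | a j => exact ⟨_, hy⟩
    | b j => exact ⟨_, hy⟩
    | x i => exact absurd ((Nat.dvd_of_mem_primeFactors hp).mul_right _) ((hcast p hp' i).1 hy)
  · intro h p hp
    by_cases hpM : p ∣ M
    · obtain ⟨j, hj⟩ := h p (Nat.mem_primeFactors.2 ⟨Nat.prime_of_mem_primeFactors hp, hpM, hM⟩)
      rcases j with j | j
      · exact ⟨a j, hj⟩
      · exact ⟨b j, hj⟩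
    · have hpp := Nat.prime_of_mem_primeFactors hp
      have hpN : p ∣ N := (hpp.dvd_mul.1 (Nat.dvd_of_mem_primeFactors hp)).resolve_right hpM
      rcases k with _ | k
      · rw [hk rfl, Nat.dvd_one] at hpN
        exact absurd hpN hpp.one_lt.ne'
      · refine ⟨x 0, (hcast p hp 0).2 fun hdvd => ?_⟩
        have h1 := (hpp.dvd_mul.1 hdvd).resolve_left hpM
        have h2 := ht 0
        rw [← ZMod.natCast_zmod_val (t 0), ZMod.isUnit_iff_coprime] at h2
        exact Nat.not_coprime_of_dvd_of_dvd hpp.one_lt h1 hpN h2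

theorem card_generatingVectors {N M : ℕ} (hN : N ≠ 0) (hM : M ≠ 0) (hk : k = 0 → N = 1) :
    Nat.card (generatingVectors g k N (N * M)) =
      Nat.card {s : Fin g ⊕ Fin g → ZMod (N * M) |
        ∀ p ∈ M.primeFactors, ∃ j, ((s j).cast : ZMod p) ≠ 0} *
      Nat.card {t : Fin k → ZMod N | (∀ i, IsUnit (t i)) ∧ ∑ i, t i = 0} := by
  have hinj := ZMod.mulEmbedding_injective hN hM
  rw [← Nat.card_prod]
  symm
  refine Nat.card_eq_of_bijective (fun q => ⟨assembleVector N M q.1.1 q.2.1, ?_⟩) ⟨?_, ?_⟩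
  · refine ⟨(closure_range_assembleVector hN hM hk _ q.2.2.1).2 q.1.2, fun i => ?_, ?_⟩
    · change addOrderOf (ZMod.mulEmbedding N M (q.2.1 i)) = N
      rw [addOrderOf_injective _ hinj, ZMod.addOrderOf_eq_iff_isUnit hN]
      exact q.2.2.1 i
    · change ∑ i, ZMod.mulEmbedding N M (q.2.1 i) = 0
      rw [← map_sum, q.2.2.2, map_zero]
  · rintro ⟨⟨s, hs⟩, ⟨t, ht⟩⟩ ⟨⟨s', hs'⟩, ⟨t', ht'⟩⟩ h
    have h : assembleVector N M s t = assembleVector N M s' t' := congrArg Subtype.val h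
    have h1 : s = s' := by
      funext j
      rcases j with j | j
      · exact congrFun h (a j)
      · exact congrFun h (b j)
    have h2 : t = t' := by
      funext i
      exact hinj (congrFun h (x i))
    subst h1 h2
    rfl
  · rintro ⟨v, hv1, hv2, hv3⟩
    have h1 : ∀ i, ∃ t, ZMod.mulEmbedding N M t = v (x i) := fun i =>
      ZMod.mem_range_mulEmbedding hN hM (by
        have := addOrderOf_nsmul_eq_zero (v (x i))
        rwa [hv2 i] at this)
    choose t ht using h1
    let s : Fin g ⊕ Fin g → ZMod (N * M) := Sum.elim (fun j => v (a j)) fun j => v (b j)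
    have hst : assembleVector N M s t = v := by
      funext y
      cases y with
      | a j => rfl
      | b j => rfl
      | x i => exact ht i
    have hu : ∀ i, IsUnit (t i) := by
      intro i
      rw [← ZMod.addOrderOf_eq_iff_isUnit hN, ← addOrderOf_injective _ hinj, ht, hv2 i]
    have hsum : ∑ i, t i = 0 := by
      apply hinj
      rw [map_sum, map_zero, ← hv3]
      exact Finset.sum_congr rfl fun i _ => ht i
    have hs := (closure_range_assembleVector hN hM hk s hu).1 (by rw [hst, hv1])
    exact ⟨⟨⟨s, hs⟩, ⟨t, hu, hsum⟩⟩, Subtype.ext hst⟩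

theorem corollary4p5 (Γ : Subgroup PSL(2, ℝ)) (g k : ℕ) (ν : Fin k → ℕ)
    (hΓ : IsCocompactFuchsianWithSignature Γ g ν)
    (N : ℕ) (hlcm : N = Finset.univ.lcm ν) (heq : ∀ i, ν i = N)
    (n : ℕ) (hn : 0 < n) :
    (¬ N ∣ n → surfaceKernelEpis Γ n = ∅) ∧
    (N ∣ n →
      (surfaceKernelEpis Γ n).Finite ∧
      ((surfaceKernelEpis Γ n).ncard : ℚ) =
        (n : ℚ) ^ (2 * g) * (Nat.totient N : ℚ) ^ k / (N : ℚ) *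
          (∏ p ∈ (n / N).primeFactors, (1 - 1 / (p : ℚ) ^ (2 * g))) *
          ∏ p ∈ N.primeFactors, (1 - (-1) ^ (k - 1) / ((p : ℚ) - 1) ^ (k - 1))) := by
  have : NeZero n := ⟨hn.ne'⟩
  obtain ⟨e⟩ := hΓ.presentation
  obtain ⟨E⟩ := nonempty_surfaceKernelEpis_equiv hΓ.fuchsian e hΓ.two_le_period heq hn.ne'
  have hk : k = 0 → N = 1 := by
    rintro rfl
    rw [hlcm]
    simp
  have hN : N ≠ 0 := by
    rcases k with _ | k
    · rw [hk rfl]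
      exact one_ne_zero
    · have := hΓ.two_le_period 0
      rw [heq] at this
      omega
  constructor
  · intro hNn
    have hempty : generatingVectors g k N n = ∅ := by
      refine Set.eq_empty_of_forall_notMem fun v hv => hNn ?_
      rcases k with _ | k
      · rw [hk rfl]
        exact one_dvd n
      · rw [← hv.2.1 0]
        have := addOrderOf_dvd_natCard (v (x 0))
        rwa [Nat.card_zmod] at this
    have : IsEmpty (surfaceKernelEpis Γ n) := by
      rw [E.isEmpty_congr, hempty]
      infer_instance
    exact Set.isEmpty_coe_sort.1 this
  · rintro ⟨M, rfl⟩
    have hM : M ≠ 0 := by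
      rintro rfl
      exact absurd hn (by simp)
    have hfinGen : Finite (FuchsianGen g k) :=
      Finite.of_surjective (fun q : (Fin g ⊕ Fin g) ⊕ Fin k => match q with
        | Sum.inl (Sum.inl j) => (a j : FuchsianGen g k)
        | Sum.inl (Sum.inr j) => b j
        | Sum.inr i => x i) fun y => match y with
        | a j => ⟨Sum.inl (Sum.inl j), rfl⟩
        | b j => ⟨Sum.inl (Sum.inr j), rfl⟩
        | x i => ⟨Sum.inr i, rfl⟩
    have hfin : Finite (surfaceKernelEpis Γ (N * M)) := Finite.of_equiv _ E.symm
    refine ⟨Set.toFinite _, ?_⟩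
    rw [← Nat.card_coe_set_eq, Nat.card_congr E, card_generatingVectors hN hM hk, Nat.cast_mul,
      card_forall_prime_ne_zero (mul_ne_zero hN hM) (dvd_mul_left M N),
      Nat.mul_div_cancel_left M (Nat.pos_of_ne_zero hN)]
    have hcard : Fintype.card (Fin g ⊕ Fin g) = 2 * g := by
      rw [Fintype.card_sum, Fintype.card_fin, two_mul]
    rw [hcard]
    -- For `k = 0` the truncated exponent `k - 1` is harmless: `N = 1` makes the product over primes
    -- of `N` empty, and the empty tuple is the only one to count.
    rcases k with _ | k
    · obtain rfl := hk rfl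
      have h1 : Nat.card {t : Fin 0 → ZMod 1 | (∀ i, IsUnit (t i)) ∧ ∑ i, t i = 0} = 1 := by
        rw [Nat.card_eq_one_iff_unique]
        exact ⟨inferInstance, ⟨⟨fun i => i.elim0, fun i => i.elim0, rfl⟩⟩⟩
      rw [h1]
      simp
    · rw [card_units_sum_eq_zero hN k, Nat.add_sub_cancel]
      ring

end FinalCount
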